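/- Let $\zeta_2(s_1,s_2)=\sum_{m=1}^{\infty}m^{-s_1}\sum_{n=1}^{\infty}(m+n)^{-s_2}$ be the Euler double zeta-function. The series converges absolutely for $\operatorname{Re}s_2>1$, $\operatorname{Re}(s_1+s_2)>2$, and $\zeta_2$ is continued holomorphically to $D=\{(s_1,s_2)\in\mathbb{C}^2 : s_2\neq 1,\ s_1+s_2\notin\{2,1,0,-2,-4,-6,\dots\}\}$. For $\sigma_1\in\mathbb{R}$ and $s_2\in\mathbb{C}$, $s_2\ne1$, put $$\zeta_2^{[1]}(\sigma_1,s_2)=\sum_{m=1}^{\infty}\frac{1}{m^{\sigma_1}}\Bigl|\zeta(s_2)-\sum_{n=1}^{m}\frac{1}{n^{s_2}}\Bigr|^2 .$$ **Theorem.** Let $\sigma_1\in\mathbb{R}$ and $s_2=\sigma_2+it_2\in\mathbb{C}$ be fixed. (a) If $s_2\neq1$ and $\sigma_1+\sigma_2>3/2$, the series $\zeta_2^{[1]}(2\sigma_1,s_2)$ converges. (b) Assume that $(\sigma_1+it_1,s_2)\in D$ for all real $t_1\ge 2$, and, for $T\ge2$, let $I^{[1]}(T)=\int_2^T|\zeta_2(\sigma_1+it_1,s_2)|^2\,dt_1$.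 Then this integral is finite for all $T\ge2$ if $\sigma_1+\sigma_2\ge 3/2$, and the following hold for all $T\ge2$, with implied constants that depend only on $\sigma_1$ and $s_2$. * If $\sigma_1+\sigma_2>2$, then $I^{[1]}(T)=\zeta_2^{[1]}(2\sigma_1,s_2)\,T+O(1)$. * If $3/2<\sigma_1+\sigma_2<2$, then $I^{[1]}(T)=\zeta_2^{[1]}(2\sigma_1,s_2)\,T+O(T^{4-2\sigma_1-2\sigma_2})$. * If $\sigma_1+\sigma_2=2$, then $I^{[1]}(T)=\zeta_2^{[1]}(2\sigma_1,s_2)\,T+O((\log T)^2)$. * If $\sigma_1+\sigma_2=3/2$, then $I^{[1]}(T)=|s_2-1|^{-2}\,T\log T+O(T)$. -/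

import Mathlib

open Set Filter Topology MeasureTheory

noncomputable section

namespace EulerDoubleZeta

/-- The double series `∑_{m ≥ 1} m^{-s₁} ∑_{n ≥ 1} (m + n)^{-s₂}` (indices shifted by one). It
converges absolutely for `Re s₂ > 1` and `Re (s₁ + s₂) > 2`. -/
def series (s₁ s₂ : ℂ) : ℂ :=
  ∑' m : ℕ, 1 / ((m : ℂ) + 1) ^ s₁ * ∑' n : ℕ, 1 / (((m : ℂ) + 1) + ((n : ℂ) + 1)) ^ s₂

/-- The complement of the singularities of the continued function: the points `(s₁, s₂)` with
`s₂ ≠ 1` and `s₁ + s₂ ∉ {2, 1, 0, -2, -4, -6, …}`. -/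
def regularSet : Set (ℂ × ℂ) :=
  {p | p.2 ≠ 1 ∧ p.1 + p.2 ≠ 2 ∧ p.1 + p.2 ≠ 1 ∧ ∀ k : ℕ, p.1 + p.2 ≠ -2 * (k : ℂ)}

/-- The part of `regularSet` in the half-space `Re (s₁ + s₂) > A`; it is connected. -/
def regularPart (A : ℝ) : Set (ℂ × ℂ) :=
  {p | p ∈ regularSet ∧ A < (p.1 + p.2).re}

/-- `F` is a holomorphic continuation of the double series to `regularPart A`. -/
def IsContinuation (A : ℝ) (F : ℂ × ℂ → ℂ) : Prop :=
  AnalyticOnNhd ℂ F (regularPart A) ∧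
    ∀ p : ℂ × ℂ, 1 < p.2.re → 2 < (p.1 + p.2).re → F p = series p.1 p.2

open Classical in
/-- The Euler double zeta-function `ζ₂(s₁, s₂)`: at a regular point, the value there of the
holomorphic continuation of the double series to a half-space `Re (s₁ + s₂) > A` containing the
point, with the singularities removed. The value does not depend on the choice of `A` and of the
continuation (see `zeta₂_eq`); it is set to `0` at the singularities. -/
def zeta₂ (s₁ s₂ : ℂ) : ℂ :=
  if h : ∃ AF : ℝ × (ℂ × ℂ → ℂ), (s₁, s₂) ∈ regularPart AF.1 ∧ IsContinuation AF.1 AF.2 then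
    (Classical.choose h).2 (s₁, s₂)
  else 0

theorem isPreconnected_regularPart (A : ℝ) : IsPreconnected (regularPart A) := by
  set S : Set ℂ := {2, 1} ∪ range (fun k : ℕ => -2 * (k : ℂ)) with hS
  have hSc : S.Countable :=
    ((Set.toFinite ({2, 1} : Set ℂ)).countable).union (countable_range _)
  set g : ℂ → ℂ := fun z => ⟨A + Real.exp z.re, z.im⟩ with hg
  have hgc : Continuous g := by
    have : g = fun z => ((A + Real.exp z.re : ℝ) : ℂ) + (z.im : ℂ) * Complex.I := by
      funext z
      apply Complex.ext
      · simp only [g, Complex.add_re, Complex.ofReal_re, Complex.mul_re, Complex.I_re,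
          Complex.ofReal_im, Complex.I_im]
        ring
      · simp [g]
    rw [this]
    fun_prop
  have hgi : Function.Injective g := by
    intro z w h
    have h1 := congrArg Complex.re h
    have h2 := congrArg Complex.im h
    simp [g] at h1 h2
    exact Complex.ext h1 h2
  have h1 : IsPreconnected ((g ⁻¹' S)ᶜ) :=
    ((hSc.preimage hgi).isConnected_compl_of_one_lt_rank (by simp)).isPreconnected
  have h2 : IsPreconnected (({1} : Set ℂ)ᶜ) :=
    (isConnected_compl_singleton_of_one_lt_rank (by simp) 1).isPreconnected
  have h3 := (h1.prod h2).image (fun p : ℂ × ℂ => (g p.1 - p.2, p.2))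
    (Continuous.continuousOn (by fun_prop))
  convert h3 using 1
  ext ⟨a, b⟩
  constructor
  · rintro ⟨⟨hb, hab2, hab1, hk⟩, hA⟩
    have hA' : 0 < (a + b).re - A := sub_pos.2 hA
    have hgz : g ⟨Real.log ((a + b).re - A), (a + b).im⟩ = a + b := by
      apply Complex.ext
      · simp only [g, Real.exp_log hA']; ring
      · simp [g]
    refine ⟨(⟨Real.log ((a + b).re - A), (a + b).im⟩, b), ⟨?_, ?_⟩, ?_⟩
    · simp only [mem_compl_iff, mem_preimage, hgz]
      rintro ((h | h) | ⟨k, h⟩)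
      · exact hab2 h
      · exact hab1 h
      · exact hk k h.symm
    · exact hb
    · simp only [hgz, add_sub_cancel_right]
  · rintro ⟨⟨z, w⟩, ⟨hz, hw⟩, h⟩
    obtain ⟨rfl, rfl⟩ := Prod.mk.inj h
    simp only [mem_compl_iff, mem_preimage] at hz
    refine ⟨⟨hw, ?_, ?_, ?_⟩, ?_⟩
    · intro h; exact hz (Or.inl (Or.inl (by simpa using h)))
    · intro h; exact hz (Or.inl (Or.inr (by simpa using h)))
    · intro k h; exact hz (Or.inr ⟨k, by simpa using h.symm⟩)
    · simp only [sub_add_cancel]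
      simp [g, Real.exp_pos]

/-- `zeta₂` is well defined: every continuation computes it. -/
theorem zeta₂_eq {A : ℝ} {F : ℂ × ℂ → ℂ} (hF : IsContinuation A F) {s₁ s₂ : ℂ}
    (h : (s₁, s₂) ∈ regularPart A) : zeta₂ s₁ s₂ = F (s₁, s₂) := by
  have hex : ∃ AF : ℝ × (ℂ × ℂ → ℂ),
      (s₁, s₂) ∈ regularPart AF.1 ∧ IsContinuation AF.1 AF.2 := ⟨(A, F), h, hF⟩
  rw [zeta₂, dif_pos hex]
  obtain ⟨hp, hG⟩ := Classical.choose_spec hex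
  set B := (Classical.choose hex).1
  set G := (Classical.choose hex).2
  have hA : regularPart (max A B) ⊆ regularPart A :=
    fun p hp => ⟨hp.1, (le_max_left _ _).trans_lt hp.2⟩
  have hB : regularPart (max A B) ⊆ regularPart B :=
    fun p hp => ⟨hp.1, (le_max_right _ _).trans_lt hp.2⟩
  set x : ℝ := max 2 (max A B) + 1 with hx
  have hx2 : 2 < x := by rw [hx]; exact lt_of_le_of_lt (le_max_left _ _) (lt_add_one _)
  have hxm : max A B < x := by rw [hx]; exact lt_of_le_of_lt (le_max_right _ _) (lt_add_one _)
  have hz : ((0 : ℂ), (x : ℂ)) ∈ regularPart (max A B) := by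
    refine ⟨⟨?_, ?_, ?_, ?_⟩, by simpa using hxm⟩
    · intro h; have := congrArg Complex.re h; simp at this; linarith
    · intro h; have := congrArg Complex.re h; simp at this; linarith
    · intro h; have := congrArg Complex.re h; simp at this; linarith
    · intro k h
      have := congrArg Complex.re h
      simp at this
      have hk : (0 : ℝ) ≤ k := k.cast_nonneg
      linarith
  refine (hG.1.mono hB).eqOn_of_preconnected_of_eventuallyEq (hF.1.mono hA)
    (isPreconnected_regularPart _) hz ?_ ⟨h.1, max_lt h.2 hp.2⟩
  have o1 : ∀ᶠ p : ℂ × ℂ in 𝓝 ((0 : ℂ), (x : ℂ)), 1 < p.2.re :=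
    (isOpen_lt continuous_const (by fun_prop)).mem_nhds (by simp; linarith)
  have o2 : ∀ᶠ p : ℂ × ℂ in 𝓝 ((0 : ℂ), (x : ℂ)), 2 < (p.1 + p.2).re :=
    (isOpen_lt continuous_const (by fun_prop)).mem_nhds (by simpa using hx2)
  filter_upwards [o1, o2] with p h1 h2
  rw [hG.2 p h1 h2, hF.2 p h1 h2]

/-- The term `m^{-σ₁} |ζ(s₂) - ∑_{n = 1}^{m} n^{-s₂}|²`. -/
def zeta₂₁Term (σ₁ : ℝ) (s₂ : ℂ) (m : ℕ) : ℝ :=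
  1 / (m : ℝ) ^ σ₁ * ‖riemannZeta s₂ - ∑ n ∈ Finset.Icc 1 m, 1 / (n : ℂ) ^ s₂‖ ^ 2

/-- The series `ζ₂^{[1]}(σ₁, s₂) = ∑_{m ≥ 1} m^{-σ₁} |ζ(s₂) - ∑_{n = 1}^{m} n^{-s₂}|²`
(for `s₂ ≠ 1`); the summation index below is `m - 1`. -/
def zeta₂₁ (σ₁ : ℝ) (s₂ : ℂ) : ℝ :=
  ∑' m : ℕ, zeta₂₁Term σ₁ s₂ (m + 1)

/-- The mean value `I^{[1]}(T) = ∫_2^T |ζ₂(σ₁ + i t₁, s₂)|² dt₁`. -/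
def meanSquare (σ₁ : ℝ) (s₂ : ℂ) (T : ℝ) : ℝ :=
  ∫ t in (2 : ℝ)..T, ‖zeta₂ ((σ₁ : ℂ) + (t : ℂ) * Complex.I) s₂‖ ^ 2

end EulerDoubleZeta

end

namespace EulerDoubleZeta

/-! ### Power sums -/

/-! Put σ = σ₁ + Re s₂ - 1 and x_m = m^{-σ₁} (ζ(s₂) - ∑_{n ≤ m} n^{-s₂}). On the line of integration
the double series is formally the Dirichlet series ∑ x_m m^{-it}, whose mean square should be T ∑
|x_m|², that is, the main term. The task is to replace this formal series, which need not converge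
when σ ≤ 1, by Dirichlet polynomials.

Euler–Maclaurin summation gives ζ(s₂) - ∑_{n ≤ m} n^{-s₂} = m^{1-s₂}/(s₂-1) + E_m(s₂) with E_m(s₂) =
O(m^{-Re s₂}) (`exists_norm_zetaErr_le`). Hence ζ₂(s₁,s₂) = ζ(w)/(s₂-1) + ∑ m^{-s₁} E_m(s₂) with w =
s₁+s₂-1, and the last series converges absolutely for Re(s₁+s₂) > 1. With Osgood's lemma this is the
holomorphic continuation to that half-space (`isContinuation_doubleZetaCont`), which contains every
line in the theorem.

On such a line Re w = σ ≥ 1/2, and ζ(w) = ∑_{n ≤ N} n^{-w} + N^{1-w}/(w-1) + O(N^{-σ}) as soon as N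
is at least a constant times the height (`exists_norm_zetaErr_le_of_height_le`). So ζ₂ differs from
∑_{m ≤ N} x_m m^{-it} by O(N^{1-σ}/t) for all N ≥ κt (`exists_isApprox_zeta₂`).

The mean square of the polynomial over [A,B] is (B-A) ∑ |x_m|² + O(∑ m|x_m|² + (∑ |x_m|)²), by
Hilbert's inequality (`abs_integral_dirichletPoly_sub_le`). Since x_m ≪ m^{-σ}, for N ≍ T the error
is O(1), O((log T)²) or O(T^{2-2σ}) according as σ > 1, σ = 1 or σ < 1. For σ > 1 one lets N → ∞ at
fixed T; for σ = 1 one takes N ≍ T; for σ < 1 one works on dyadic blocks [T/2,T], where the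
approximation error is O(T^{-σ}). At σ = 1/2 the sum ∑ |x_m|² diverges, but |x_m|² = |s₂-1|^{-2}
m^{-1} + O(m^{-2}), so its partial sums produce the factor log T. -/

theorem mul_rpow_le_rpow_sub_rpow {α : ℝ} (hα : 0 < α) {x : ℝ} (hx : 0 < x) :
    α * (x + 1) ^ (-(α + 1)) ≤ x ^ (-α) - (x + 1) ^ (-α) := by
  have h1 : 0 < x + 1 := by linarith
  have hq : 0 < x / (x + 1) := by positivity
  have e1 : x ^ (-α) = (x + 1) ^ (-α) * (x / (x + 1)) ^ (-α) := by
    rw [← Real.mul_rpow h1.le hq.le]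
    congr 1
    field_simp
  have e2 : (x + 1) ^ (-(α + 1)) = (x + 1) ^ (-α) * (1 / (x + 1)) := by
    rw [show -(α + 1) = -α - 1 by ring, Real.rpow_sub_one h1.ne']
    ring
  have h3 : 1 + α * (1 / (x + 1)) ≤ (x / (x + 1)) ^ (-α) := by
    rw [Real.rpow_def_of_pos hq]
    have h4 := Real.log_le_sub_one_of_pos hq
    have h5 := Real.add_one_le_exp (Real.log (x / (x + 1)) * -α)
    have h6 : x / (x + 1) - 1 = -(1 / (x + 1)) := by field_simp; ring
    rw [h6] at h4
    nlinarith
  have h7 : 0 < (x + 1) ^ (-α) := Real.rpow_pos_of_pos h1 _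
  rw [e1, e2]
  nlinarith

/-- Telescoping form of the comparison with ∫_N^∞ x^{-α-1} dx; the sum starts at N + 1, so no
boundary term appears. -/
theorem sum_range_rpow_le {α : ℝ} (hα : 0 < α) {N : ℕ} (hN : 1 ≤ N) (M : ℕ) :
    ∑ i ∈ Finset.range M, ((N : ℝ) + i + 1) ^ (-(α + 1)) ≤ (N : ℝ) ^ (-α) / α := by
  have hN' : (1 : ℝ) ≤ N := by exact_mod_cast hN
  rw [le_div_iff₀ hα, Finset.sum_mul]
  calc ∑ i ∈ Finset.range M, ((N : ℝ) + i + 1) ^ (-(α + 1)) * α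
      ≤ ∑ i ∈ Finset.range M, (((N : ℝ) + i) ^ (-α) - ((N : ℝ) + (i + 1 : ℕ)) ^ (-α)) := by
        refine Finset.sum_le_sum fun i _ => ?_
        have := mul_rpow_le_rpow_sub_rpow hα (x := (N : ℝ) + i) (by positivity)
        rw [mul_comm]
        push_cast
        rw [← add_assoc]
        exact this
    _ = (N : ℝ) ^ (-α) - ((N : ℝ) + M) ^ (-α) := by
        rw [Finset.sum_range_sub' (fun i : ℕ => ((N : ℝ) + i) ^ (-α))]
        simp
    _ ≤ (N : ℝ) ^ (-α) := by
        have : 0 ≤ ((N : ℝ) + M) ^ (-α) := by positivity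
        linarith

theorem summable_rpow_shift {α : ℝ} (hα : 0 < α) {N : ℕ} (hN : 1 ≤ N) :
    Summable fun i : ℕ => ((N : ℝ) + i + 1) ^ (-(α + 1)) :=
  summable_of_sum_range_le (fun i => by positivity) (sum_range_rpow_le hα hN)

theorem tsum_rpow_shift_le {α : ℝ} (hα : 0 < α) {N : ℕ} (hN : 1 ≤ N) :
    ∑' i : ℕ, ((N : ℝ) + i + 1) ^ (-(α + 1)) ≤ (N : ℝ) ^ (-α) / α :=
  Real.tsum_le_of_sum_range_le (fun i => by positivity) (sum_range_rpow_le hα hN)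

theorem sum_Icc_rpow_le_of_one_lt {α : ℝ} (hα : 1 < α) (N : ℕ) :
    ∑ m ∈ Finset.Icc 1 N, (m : ℝ) ^ (-α) ≤ 1 + 1 / (α - 1) := by
  rcases Nat.eq_zero_or_pos N with rfl | hN
  · have : 0 < 1 / (α - 1) := one_div_pos.2 (by linarith)
    rw [Finset.Icc_eq_empty (by omega), Finset.sum_empty]
    linarith
  have h := sum_range_rpow_le (α := α - 1) (by linarith) le_rfl (N - 1)
  rw [← Finset.Ico_succ_right_eq_Icc, Finset.sum_eq_sum_Ico_succ_bot (by simpa using hN),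
    Finset.sum_Ico_eq_sum_range]
  simp only [Nat.cast_one, Real.one_rpow] at h ⊢
  simp only [Order.succ_eq_add_one]
  have e : ∀ i : ℕ, (((1 + 1 + i : ℕ) : ℝ)) ^ (-α) = ((1 : ℝ) + i + 1) ^ (-(α - 1 + 1)) := by
    intro i
    push_cast
    congr 1 <;> ring
  simp only [e]
  rw [show N + 1 - (1 + 1) = N - 1 by omega]
  linarith

theorem sum_Icc_rpow_le_of_lt_one {α : ℝ} (h0 : 0 ≤ α) (h1 : α < 1) (N : ℕ) :
    ∑ m ∈ Finset.Icc 1 N, (m : ℝ) ^ (-α) ≤ (N : ℝ) ^ (1 - α) / (1 - α) := by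
  have hα : 0 < 1 - α := by linarith
  induction N with
  | zero => simp [hα.ne']
  | succ n ih =>
    rw [Finset.sum_Icc_succ_top (by omega)]
    push_cast
    have hn : (0 : ℝ) < (n : ℝ) + 1 := by positivity
    have key : (n : ℝ) ^ (1 - α) ≤ ((n : ℝ) + 1) ^ (1 - α) - (1 - α) * ((n : ℝ) + 1) ^ (-α) := by
      -- Bernoulli's inequality for an exponent in (0, 1], applied to n/(n+1) = 1 - 1/(n+1).
      have b := rpow_one_add_le_one_add_mul_self (s := -(1 / ((n : ℝ) + 1)))
        (by rw [neg_le_neg_iff, div_le_one hn]; linarith [n.cast_nonneg (α := ℝ)])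
        (p := 1 - α) (by linarith) (by linarith)
      have e1 : (n : ℝ) ^ (1 - α) = ((n : ℝ) + 1) ^ (1 - α) * (1 + -(1 / ((n : ℝ) + 1))) ^ (1 - α) := by
        have : (1 : ℝ) + -(1 / ((n : ℝ) + 1)) = n / (n + 1) := by field_simp; ring
        rw [this, ← Real.mul_rpow hn.le (by positivity)]
        congr 1
        field_simp
      have e2 : ((n : ℝ) + 1) ^ (-α) = ((n : ℝ) + 1) ^ (1 - α) * (1 / ((n : ℝ) + 1)) := by
        rw [show -α = (1 - α) - 1 by ring, Real.rpow_sub_one hn.ne']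
        ring
      have h7 : 0 < ((n : ℝ) + 1) ^ (1 - α) := Real.rpow_pos_of_pos hn _
      rw [e1, e2]
      nlinarith
    rw [le_div_iff₀ hα] at ih ⊢
    nlinarith

theorem sum_Icc_rpow_neg_one_le (N : ℕ) :
    ∑ m ∈ Finset.Icc 1 N, (m : ℝ) ^ (-1 : ℝ) ≤ 1 + Real.log N := by
  have := harmonic_le_one_add_log N
  rw [harmonic_eq_sum_Icc] at this
  push_cast at this
  simpa [Real.rpow_neg_one] using this

/-! ### Hilbert's inequality -/

open Complex in
theorem integral_exp_int (k : ℤ) :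
    ∫ u in (0 : ℝ)..1, exp (2 * Real.pi * I * k * u) = if k = 0 then 1 else 0 := by
  split_ifs with hk
  · simp [hk]
  · have hl : 2 * (Real.pi : ℂ) * I * k ≠ 0 := by
      simp [hk, Real.pi_ne_zero, I_ne_zero]
    rw [integral_exp_mul_complex hl]
    have : exp (2 * Real.pi * I * k * ((1 : ℝ) : ℂ)) = 1 := by
      rw [show 2 * (Real.pi : ℂ) * I * k * ((1 : ℝ) : ℂ) = k * (2 * Real.pi * I) by push_cast; ring]
      exact exp_int_mul_two_pi_mul_I k
    rw [this]
    simp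

open Complex in
-- The sawtooth u - 1/2 has Fourier coefficients proportional to 1/k. At k = 0 both sides vanish,
-- the right one by the convention on inverses.
theorem integral_mul_exp_int (k : ℤ) :
    ∫ u in (0 : ℝ)..1, ((u : ℂ) - 1 / 2) * exp (2 * Real.pi * I * k * u) =
      (2 * Real.pi * I * k)⁻¹ := by
  by_cases hk : k = 0
  · simp only [hk, Int.cast_zero, mul_zero, zero_mul, exp_zero, mul_one, inv_zero]
    have : ∀ u : ℝ, (u : ℂ) - 1 / 2 = ((u - 1 / 2 : ℝ) : ℂ) := by intro u; push_cast; ring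
    simp_rw [this]
    rw [intervalIntegral.integral_ofReal]
    norm_num
  · have hl : 2 * (Real.pi : ℂ) * I * k ≠ 0 := by
      simp [hk, Real.pi_ne_zero, I_ne_zero]
    set l := 2 * (Real.pi : ℂ) * I * k with hl'
    have h1 : exp l = 1 := by
      rw [hl', show 2 * (Real.pi : ℂ) * I * k = k * (2 * Real.pi * I) by ring]
      exact exp_int_mul_two_pi_mul_I k
    have hd : ∀ u ∈ uIcc (0 : ℝ) 1, HasDerivAt
        (fun u : ℝ => (((u : ℂ) - 1 / 2) / l - 1 / l ^ 2) * exp (l * u))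
        (((u : ℂ) - 1 / 2) * exp (l * u)) u := by
      intro u _
      have a1 : HasDerivAt (fun u : ℝ => (u : ℂ)) 1 u := ofRealCLM.hasDerivAt
      have a2 := ((a1.sub_const (1 / 2)).div_const l).sub_const (1 / l ^ 2)
      have a3 := (a1.const_mul l).cexp
      refine (a2.mul a3).congr_deriv ?_
      field_simp
      ring
    rw [intervalIntegral.integral_eq_sub_of_hasDerivAt hd
      (Continuous.intervalIntegrable (by fun_prop) _ _)]
    simp [h1]
    ring

open Complex ComplexConjugate in
/-- Hilbert's inequality. The diagonal terms vanish by the convention on division by zero. -/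
theorem norm_hilbert_form_le (s : Finset ℕ) (x : ℕ → ℂ) :
    ‖∑ m ∈ s, ∑ n ∈ s, x m * conj (x n) / ((m : ℂ) - n)‖ ≤ Real.pi * ∑ m ∈ s, ‖x m‖ ^ 2 := by
  -- The form equals 2πi ∫₀¹ (u - 1/2) |P(u)|² du. As |u - 1/2| ≤ 1/2, Parseval bounds it by 2π ·
  -- (1/2) · ∑ |x_m|².
  set P : ℝ → ℂ := fun u => ∑ m ∈ s, x m * exp (2 * Real.pi * I * m * u) with hP
  have hPc : Continuous P := by fun_prop
  have hsq : ∀ u, ((‖P u‖ ^ 2 : ℝ) : ℂ) =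
      ∑ m ∈ s, ∑ n ∈ s, x m * conj (x n) * exp (2 * Real.pi * I * ((m : ℤ) - n : ℤ) * u) := by
    intro u
    have : ((‖P u‖ ^ 2 : ℝ) : ℂ) = P u * conj (P u) := by
      rw [mul_conj, normSq_eq_norm_sq]
    rw [this, hP]
    simp only [map_sum, Finset.sum_mul_sum, map_mul]
    refine Finset.sum_congr rfl fun m _ => Finset.sum_congr rfl fun n _ => ?_
    rw [← exp_conj]
    simp only [map_mul, conj_I, conj_ofReal, map_natCast, map_ofNat]
    rw [mul_mul_mul_comm, ← exp_add]
    congr 2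
    push_cast
    ring
  have h1 : ∫ u in (0 : ℝ)..1, ‖P u‖ ^ 2 = ∑ m ∈ s, ‖x m‖ ^ 2 := by
    have : ((∫ u in (0 : ℝ)..1, ‖P u‖ ^ 2 : ℝ) : ℂ) = ((∑ m ∈ s, ‖x m‖ ^ 2 : ℝ) : ℂ) := by
      rw [← intervalIntegral.integral_ofReal]
      simp_rw [hsq]
      rw [intervalIntegral.integral_finsetSum
        (fun m _ => Continuous.intervalIntegrable (by fun_prop) _ _)]
      push_cast
      refine Finset.sum_congr rfl fun m hm => ?_
      rw [intervalIntegral.integral_finsetSum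
        (fun m _ => Continuous.intervalIntegrable (by fun_prop) _ _)]
      simp_rw [intervalIntegral.integral_const_mul, ← Int.cast_natCast (R := ℂ), ← Int.cast_sub,
        integral_exp_int, sub_eq_zero, Nat.cast_inj]
      simp only [mul_ite, mul_one, mul_zero, Finset.sum_ite_eq, hm, if_true]
      rw [mul_conj, normSq_eq_norm_sq]
      push_cast
      rfl
    exact_mod_cast this
  have h2 : ∫ u in (0 : ℝ)..1, ((u : ℂ) - 1 / 2) * ((‖P u‖ ^ 2 : ℝ) : ℂ) =
      (2 * Real.pi * I)⁻¹ * ∑ m ∈ s, ∑ n ∈ s, x m * conj (x n) / ((m : ℂ) - n) := by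
    simp_rw [hsq, Finset.mul_sum]
    rw [intervalIntegral.integral_finsetSum
      (fun m _ => Continuous.intervalIntegrable (by fun_prop) _ _)]
    refine Finset.sum_congr rfl fun m hm => ?_
    rw [intervalIntegral.integral_finsetSum
      (fun m _ => Continuous.intervalIntegrable (by fun_prop) _ _)]
    refine Finset.sum_congr rfl fun n hn => ?_
    have : ∀ u : ℝ, ((u : ℂ) - 1 / 2) * (x m * conj (x n) *
        exp (2 * Real.pi * I * ((m : ℤ) - n : ℤ) * u)) = x m * conj (x n) *
        (((u : ℂ) - 1 / 2) * exp (2 * Real.pi * I * ((m : ℤ) - n : ℤ) * u)) := fun u => by ring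
    simp_rw [this]
    rw [intervalIntegral.integral_const_mul, integral_mul_exp_int]
    push_cast
    rw [mul_inv (2 * (Real.pi : ℂ) * I)]
    ring
  have h3 : ‖∫ u in (0 : ℝ)..1, ((u : ℂ) - 1 / 2) * ((‖P u‖ ^ 2 : ℝ) : ℂ)‖ ≤
      ∫ u in (0 : ℝ)..1, 1 / 2 * ‖P u‖ ^ 2 := by
    refine intervalIntegral.norm_integral_le_of_norm_le zero_le_one ?_
      (Continuous.intervalIntegrable (by fun_prop) _ _)
    refine ae_of_all _ fun u hu => ?_
    rw [norm_mul, norm_real, Real.norm_of_nonneg (by positivity)]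
    refine mul_le_mul_of_nonneg_right ?_ (by positivity)
    rw [show (u : ℂ) - 1 / 2 = ((u - 1 / 2 : ℝ) : ℂ) by push_cast; ring, norm_real, Real.norm_eq_abs,
      abs_le]
    constructor <;> linarith [hu.1, hu.2]
  rw [h2, intervalIntegral.integral_const_mul, h1, norm_mul, norm_inv, norm_mul, norm_mul] at h3
  simp only [Complex.norm_ofNat, norm_real, Real.norm_eq_abs, abs_of_pos Real.pi_pos, norm_I,
    mul_one] at h3
  have hpi := Real.pi_pos
  rw [inv_mul_le_iff₀ (by positivity)] at h3
  linarith

/-! ### Mean values of Dirichlet polynomials -/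

/-- For m < n both 1/log(n/m) and √(mn)/(n-m) lie between m/(n-m) and n/(n-m), which differ by 1.
This transfers Hilbert's inequality from integer frequencies to logarithms of integers. -/
theorem abs_inv_log_sub_le {m n : ℕ} (hm : 1 ≤ m) (hn : 1 ≤ n) (hmn : m ≠ n) :
    |1 / (Real.log n - Real.log m) - Real.sqrt m * Real.sqrt n / ((n : ℝ) - m)| ≤ 2 := by
  wlog h : m < n generalizing m n
  · have := this hn hm hmn.symm (by omega)
    rw [← abs_neg] at this
    convert this using 2
    rw [← neg_sub (Real.log n), ← neg_sub (n : ℝ), div_neg, div_neg]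
    ring
  have hm0 : (0 : ℝ) < m := by exact_mod_cast hm
  have hn0 : (0 : ℝ) < n := by exact_mod_cast hn
  have hd : (m : ℝ) < n := by exact_mod_cast h
  have hd' : (0 : ℝ) < n - m := by linarith
  have l1 := Real.log_le_sub_one_of_pos (x := (n : ℝ) / m) (by positivity)
  have l2 := Real.one_sub_inv_le_log_of_pos (x := (n : ℝ) / m) (by positivity)
  rw [Real.log_div hn0.ne' hm0.ne'] at l1 l2
  set L := Real.log n - Real.log m
  have l1' : L ≤ (n - m) / m := by convert l1 using 1; field_simp
  have l2' : (n - m) / n ≤ L := by convert l2 using 1; field_simp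
  have hL : 0 < L := lt_of_lt_of_le (by positivity) l2'
  have b1 : m / ((n : ℝ) - m) ≤ 1 / L := by
    rw [div_le_div_iff₀ hd' hL]
    rw [le_div_iff₀ hm0] at l1'
    linarith
  have b2 : 1 / L ≤ n / ((n : ℝ) - m) := by
    rw [div_le_div_iff₀ hL hd']
    rw [div_le_iff₀ hn0] at l2'
    linarith
  have s1 : (m : ℝ) ≤ Real.sqrt m * Real.sqrt n := by
    calc (m : ℝ) = Real.sqrt m * Real.sqrt m := (Real.mul_self_sqrt hm0.le).symm
      _ ≤ _ := by gcongr
  have s2 : Real.sqrt m * Real.sqrt n ≤ n := by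
    calc Real.sqrt m * Real.sqrt n ≤ Real.sqrt n * Real.sqrt n := by gcongr
      _ = n := Real.mul_self_sqrt hn0.le
  have c1 : m / ((n : ℝ) - m) ≤ Real.sqrt m * Real.sqrt n / ((n : ℝ) - m) := by gcongr
  have c2 : Real.sqrt m * Real.sqrt n / ((n : ℝ) - m) ≤ n / ((n : ℝ) - m) := by gcongr
  have c3 : n / ((n : ℝ) - m) = m / ((n : ℝ) - m) + 1 := by field_simp; ring
  rw [abs_le]
  constructor <;> linarith

open Complex ComplexConjugate in
-- The kernel is √(mn)/(n-m) plus a bounded kernel. Hilbert's inequality for √m x_m handles the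
-- first part and gives the weights m; the second is bounded trivially by (∑ |x_m|)². This last term
-- is never larger than the final error terms allow.
theorem norm_log_form_le (N : ℕ) (x : ℕ → ℂ) :
    ‖∑ m ∈ Finset.Icc 1 N, ∑ n ∈ Finset.Icc 1 N,
      x m * conj (x n) / ((Real.log n - Real.log m : ℝ) : ℂ)‖ ≤
      Real.pi * ∑ m ∈ Finset.Icc 1 N, m * ‖x m‖ ^ 2 +
        2 * (∑ m ∈ Finset.Icc 1 N, ‖x m‖) ^ 2 := by
  set s := Finset.Icc 1 N
  set y : ℕ → ℂ := fun m => (Real.sqrt m : ℂ) * x m with hy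
  have hH := norm_hilbert_form_le s y
  have e1 : ∀ m, ‖y m‖ ^ 2 = m * ‖x m‖ ^ 2 := by
    intro m
    rw [hy, norm_mul, norm_real, Real.norm_of_nonneg (Real.sqrt_nonneg _), mul_pow,
      Real.sq_sqrt (Nat.cast_nonneg _)]
  simp_rw [e1] at hH
  have e2 : ∑ m ∈ s, ∑ n ∈ s, x m * conj (x n) / ((Real.log n - Real.log m : ℝ) : ℂ) =
      -(∑ m ∈ s, ∑ n ∈ s, y m * conj (y n) / ((m : ℂ) - n)) +
      ∑ m ∈ s, ∑ n ∈ s, x m * conj (x n) *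
        ((1 / (Real.log n - Real.log m) - Real.sqrt m * Real.sqrt n / ((n : ℝ) - m) : ℝ) : ℂ) := by
    rw [← Finset.sum_neg_distrib, ← Finset.sum_add_distrib]
    refine Finset.sum_congr rfl fun m _ => ?_
    rw [← Finset.sum_neg_distrib, ← Finset.sum_add_distrib]
    refine Finset.sum_congr rfl fun n _ => ?_
    simp only [hy, map_mul, conj_ofReal]
    rw [← neg_sub (n : ℂ) m, div_neg]
    push_cast
    ring
  rw [e2]
  refine (norm_add_le _ _).trans (add_le_add (by rwa [norm_neg]) ?_)
  calc _ ≤ ∑ m ∈ s, ∑ n ∈ s, ‖x m‖ * ‖x n‖ * 2 := by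
        refine (norm_sum_le _ _).trans (Finset.sum_le_sum fun m hm => ?_)
        refine (norm_sum_le _ _).trans (Finset.sum_le_sum fun n hn => ?_)
        rw [norm_mul, norm_mul, RCLike.norm_conj, norm_real, Real.norm_eq_abs]
        gcongr
        by_cases hmn : m = n
        · simp [hmn]
        · exact abs_inv_log_sub_le (Finset.mem_Icc.1 hm).1 (Finset.mem_Icc.1 hn).1 hmn
    _ = 2 * (∑ m ∈ s, ‖x m‖) ^ 2 := by
        rw [sq, Finset.sum_mul_sum, Finset.mul_sum]
        refine Finset.sum_congr rfl fun m _ => ?_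
        rw [Finset.mul_sum]
        exact Finset.sum_congr rfl fun n _ => by ring

open Complex in
-- At l = 0 the quotient is zero by convention, so a single formula serves the diagonal and
-- off-diagonal terms alike.
theorem integral_exp_mul_I (l A B : ℝ) :
    ∫ t in A..B, exp (t * l * I) = (if l = 0 then ((B - A : ℝ) : ℂ) else 0) +
      (exp (B * l * I) - exp (A * l * I)) / (l * I) := by
  split_ifs with h
  · simp [h]
  · have hl : (l : ℂ) * I ≠ 0 := by simp [h, I_ne_zero]
    have := integral_exp_mul_complex (a := A) (b := B) hl
    rw [zero_add, mul_assoc, mul_assoc, mul_comm (B : ℂ), mul_comm (A : ℂ), ← this]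
    refine intervalIntegral.integral_congr fun t _ => ?_
    congr 1
    ring

open Complex ComplexConjugate in
/-- The mean value theorem for Dirichlet polynomials. -/
theorem abs_integral_dirichletPoly_sub_le (N : ℕ) (x : ℕ → ℂ) (A B : ℝ) :
    |(∫ t in A..B, ‖∑ m ∈ Finset.Icc 1 N, x m * exp (-(t * Real.log m * I))‖ ^ 2) -
      (B - A) * ∑ m ∈ Finset.Icc 1 N, ‖x m‖ ^ 2| ≤
      2 * (Real.pi * ∑ m ∈ Finset.Icc 1 N, m * ‖x m‖ ^ 2 +
        2 * (∑ m ∈ Finset.Icc 1 N, ‖x m‖) ^ 2) := by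
  set s := Finset.Icc 1 N with hs
  -- Up to the factor 1/I, the antiderivative of the off-diagonal part of the squared modulus. It is
  -- a logarithmic Hilbert form in the twisted coefficients x_m m^{-iT}, which have the same moduli
  -- as x_m, so its bound does not depend on T.
  set Q : ℝ → ℂ := fun T => ∑ m ∈ s, ∑ n ∈ s,
    (x m * exp (-(T * Real.log m * I))) * conj (x n * exp (-(T * Real.log n * I))) /
      ((Real.log n - Real.log m : ℝ) : ℂ) with hQ
  have hnorm : ∀ (T : ℝ) (m : ℕ), ‖x m * exp (-(T * Real.log m * I))‖ = ‖x m‖ := by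
    intro T m
    rw [norm_mul, show -((T : ℂ) * Real.log m * I) = ((-(T * Real.log m) : ℝ) : ℂ) * I by
      push_cast; ring, norm_exp_ofReal_mul_I, mul_one]
  have hQb : ∀ T, ‖Q T‖ ≤ Real.pi * ∑ m ∈ s, m * ‖x m‖ ^ 2 + 2 * (∑ m ∈ s, ‖x m‖) ^ 2 := by
    intro T
    have := norm_log_form_le N (fun m => x m * exp (-(T * Real.log m * I)))
    simp_rw [hnorm] at this
    exact this
  have hprod : ∀ (t : ℝ) (m n : ℕ),
      (x m * exp (-(t * Real.log m * I))) * conj (x n * exp (-(t * Real.log n * I))) =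
      x m * conj (x n) * exp (t * (Real.log n - Real.log m : ℝ) * I) := by
    intro t m n
    rw [map_mul, ← exp_conj, mul_mul_mul_comm, ← exp_add]
    congr 2
    simp only [map_neg, map_mul, conj_ofReal, conj_I]
    push_cast
    ring
  have key : (((∫ t in A..B, ‖∑ m ∈ s, x m * exp (-(t * Real.log m * I))‖ ^ 2) -
      (B - A) * ∑ m ∈ s, ‖x m‖ ^ 2 : ℝ) : ℂ) = (Q B - Q A) / I := by
    rw [ofReal_sub, ← intervalIntegral.integral_ofReal]
    have hsq : ∀ t : ℝ, ((‖∑ m ∈ s, x m * exp (-(t * Real.log m * I))‖ ^ 2 : ℝ) : ℂ) =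
        ∑ m ∈ s, ∑ n ∈ s, x m * conj (x n) * exp (t * (Real.log n - Real.log m : ℝ) * I) := by
      intro t
      rw [← normSq_eq_norm_sq, ← mul_conj, map_sum, Finset.sum_mul_sum]
      simp_rw [hprod]
    simp_rw [hsq]
    rw [intervalIntegral.integral_finsetSum
      (fun m _ => Continuous.intervalIntegrable (by fun_prop) _ _), sub_eq_iff_eq_add, hQ]
    simp only
    rw [← Finset.sum_sub_distrib, Finset.sum_div]
    rw [Finset.mul_sum, ofReal_sum, ← Finset.sum_add_distrib]
    refine Finset.sum_congr rfl fun m hm => ?_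
    rw [intervalIntegral.integral_finsetSum
      (fun m _ => Continuous.intervalIntegrable (by fun_prop) _ _)]
    simp_rw [intervalIntegral.integral_const_mul, hprod, integral_exp_mul_I, mul_add,
      Finset.sum_add_distrib]
    rw [add_comm]
    congr 1
    · rw [← Finset.sum_sub_distrib, Finset.sum_div]
      refine Finset.sum_congr rfl fun n _ => ?_
      push_cast
      rw [← sub_div, ← mul_sub, div_div, mul_div_assoc]
    · rw [Finset.sum_eq_single m]
      · rw [sub_self, if_pos rfl, mul_conj, normSq_eq_norm_sq]
        push_cast
        ring
      · intro n hn hne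
        rw [if_neg, mul_zero]
        rw [sub_eq_zero]
        intro h
        apply hne
        have := Real.log_injOn_pos (mem_Ioi.2 (by exact_mod_cast (Finset.mem_Icc.1 hn).1))
          (mem_Ioi.2 (by exact_mod_cast (Finset.mem_Icc.1 hm).1)) h
        exact_mod_cast this
      · intro h; exact absurd hm h
  rw [← Real.norm_eq_abs, ← norm_real, key, norm_div, norm_I, div_one]
  refine (norm_sub_le _ _).trans ?_
  linarith [hQb A, hQb B]

/-! ### The remainder in the approximation of `ζ` by partial sums -/

/-- The remainder `ζ(s) - ∑_{n ≤ m} n^{-s} - m^{1-s} / (s - 1)`. -/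
noncomputable def zetaErr (m : ℕ) (s : ℂ) : ℂ :=
  riemannZeta s - ∑ n ∈ Finset.Icc 1 m, 1 / (n : ℂ) ^ s - (m : ℂ) ^ (1 - s) / (s - 1)

/-- The integral `∫_m^∞ B_j({x}) x^{-s-j} dx`. -/
noncomputable def bernoulliIntegral (j m : ℕ) (s : ℂ) : ℂ :=
  ∫ x in Ioi (m : ℝ), (bernoulliFun j (Int.fract x) : ℂ) * (x : ℂ) ^ (-s - j)

theorem exists_bernoulliFun_fract_le (j : ℕ) :
    ∃ B : ℝ, 0 ≤ B ∧ ∀ x : ℝ, |bernoulliFun j (Int.fract x)| ≤ B := by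
  obtain ⟨B, hB⟩ := (isCompact_Icc (a := (0 : ℝ)) (b := 1)).exists_bound_of_continuousOn
    (continuous_bernoulliFun j).continuousOn
  have h : ∀ x : ℝ, |bernoulliFun j (Int.fract x)| ≤ B := fun x =>
    hB _ ⟨Int.fract_nonneg x, (Int.fract_lt_one x).le⟩
  exact ⟨B, (abs_nonneg _).trans (h 0), h⟩

theorem measurable_bernoulliFun_fract (j : ℕ) :
    Measurable fun x : ℝ => bernoulliFun j (Int.fract x) :=
  (continuous_bernoulliFun j).measurable.comp measurable_fract

theorem norm_natCast_cpow {m : ℕ} (hm : 1 ≤ m) (s : ℂ) : ‖(m : ℂ) ^ s‖ = (m : ℝ) ^ s.re := by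
  have := Complex.norm_cpow_eq_rpow_re_of_pos (x := (m : ℝ)) (by exact_mod_cast hm) s
  simpa using this

theorem norm_bernoulli_integrand_le {j : ℕ} {B : ℝ}
    (hB : ∀ x : ℝ, |bernoulliFun j (Int.fract x)| ≤ B) (s : ℂ) {x : ℝ} (hx : 0 < x) :
    ‖(bernoulliFun j (Int.fract x) : ℂ) * (x : ℂ) ^ (-s - j)‖ ≤ B * x ^ (-s.re - j) := by
  rw [norm_mul, Complex.norm_real, Real.norm_eq_abs, Complex.norm_cpow_eq_rpow_re_of_pos hx]
  simp only [Complex.sub_re, Complex.neg_re, Complex.natCast_re]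
  exact mul_le_mul_of_nonneg_right (hB x) (by positivity)

theorem integrableOn_bernoulli_integrand (j : ℕ) {m : ℕ} (hm : 1 ≤ m) {s : ℂ}
    (hs : 1 < s.re + j) :
    IntegrableOn (fun x : ℝ => (bernoulliFun j (Int.fract x) : ℂ) * (x : ℂ) ^ (-s - j))
      (Ioi (m : ℝ)) := by
  obtain ⟨B, -, hB⟩ := exists_bernoulliFun_fract_le j
  have hm' : (0 : ℝ) < m := by exact_mod_cast hm
  have hi : IntegrableOn (fun x : ℝ => B * x ^ (-s.re - j)) (Ioi (m : ℝ)) :=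
    (integrableOn_Ioi_rpow_of_lt (by linarith) hm').const_mul B
  refine Integrable.mono' hi ?_ ?_
  · refine Measurable.aestronglyMeasurable ?_
    have := measurable_bernoulliFun_fract j
    exact (Complex.measurable_ofReal.comp this).mul (Complex.measurable_ofReal.pow_const _)
  · filter_upwards [self_mem_ae_restrict measurableSet_Ioi] with x hx
    exact norm_bernoulli_integrand_le hB s (hm'.trans hx)

theorem norm_bernoulliIntegral_le {j : ℕ} {B : ℝ}
    (hB : ∀ x : ℝ, |bernoulliFun j (Int.fract x)| ≤ B) {m : ℕ} (hm : 1 ≤ m) {s : ℂ}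
    (hs : 1 < s.re + j) :
    ‖bernoulliIntegral j m s‖ ≤ B * ((m : ℝ) ^ (1 - s.re - j) / (s.re + j - 1)) := by
  have hm' : (0 : ℝ) < m := by exact_mod_cast hm
  have hi : IntegrableOn (fun x : ℝ => B * x ^ (-s.re - j)) (Ioi (m : ℝ)) :=
    (integrableOn_Ioi_rpow_of_lt (by linarith) hm').const_mul B
  have h := norm_integral_le_of_norm_le hi (f := fun x : ℝ =>
    (bernoulliFun j (Int.fract x) : ℂ) * (x : ℂ) ^ (-s - j)) (by
      filter_upwards [self_mem_ae_restrict measurableSet_Ioi] with x hx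
      exact norm_bernoulli_integrand_le hB s (hm'.trans hx))
  rw [integral_const_mul, integral_Ioi_rpow_of_lt (by linarith) hm'] at h
  refine h.trans_eq ?_
  rw [← neg_div_neg_eq, neg_neg]
  ring_nf

/-! ### Euler–Maclaurin summation. -/

theorem hasDerivAt_ofReal_cpow {x : ℝ} (hx : 0 < x) (c : ℂ) :
    HasDerivAt (fun y : ℝ => (y : ℂ) ^ c) (c * (x : ℂ) ^ (c - 1)) x :=
  (Complex.hasStrictDerivAt_cpow_const (Or.inl hx)).hasDerivAt.comp_ofReal

/-- Integration by parts on [k, k+1], with B_{j+1}/(j+1) as antiderivative of B_j. The fractional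
part equals x - k except at the right endpoint, a null set. -/
theorem integral_bernoulli_unit (j : ℕ) {k : ℕ} (hk : 1 ≤ k) (s : ℂ) :
    (∫ x in (k : ℝ)..(k + 1 : ℕ), (bernoulliFun j (Int.fract x) : ℂ) * (x : ℂ) ^ (-s - j)) -
      (s + j) / (j + 1) * (∫ x in (k : ℝ)..(k + 1 : ℕ),
        (bernoulliFun (j + 1) (Int.fract x) : ℂ) * (x : ℂ) ^ (-s - (j + 1 : ℕ))) =
    (bernoulliFun (j + 1) 1 * ((k + 1 : ℕ) : ℂ) ^ (-s - j) -
      bernoulliFun (j + 1) 0 * (k : ℂ) ^ (-s - j)) / (j + 1) := by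
  have hk' : (0 : ℝ) < k := by exact_mod_cast hk
  have hle : (k : ℝ) ≤ (k + 1 : ℕ) := by push_cast; linarith
  have hfr : ∀ (i : ℕ) (c : ℂ),
      ∫ x in (k : ℝ)..(k + 1 : ℕ), (bernoulliFun i (Int.fract x) : ℂ) * (x : ℂ) ^ c =
      ∫ x in (k : ℝ)..(k + 1 : ℕ), (bernoulliFun i (x - k) : ℂ) * (x : ℂ) ^ c := by
    intro i c
    refine intervalIntegral.integral_congr_ae ?_
    have hne : ∀ᵐ x : ℝ, x ≠ (k + 1 : ℕ) := by
      simp [ae_iff, measure_singleton]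
    filter_upwards [hne] with x hx hx2
    rw [uIoc_of_le hle] at hx2
    have hlt : x < k + 1 := by
      have := lt_of_le_of_ne hx2.2 hx
      push_cast at this
      exact this
    have : ⌊x⌋ = (k : ℤ) := Int.floor_eq_iff.2 ⟨by exact_mod_cast hx2.1.le, by exact_mod_cast hlt⟩
    rw [Int.fract, this]
    push_cast
    rfl
  have hc : ∀ (i : ℕ) (c : ℂ), IntervalIntegrable
      (fun x : ℝ => (bernoulliFun i (x - k) : ℂ) * (x : ℂ) ^ c) volume (k : ℝ) (k + 1 : ℕ) := by
    intro i c
    refine ContinuousOn.intervalIntegrable fun x hx => ContinuousAt.continuousWithinAt ?_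
    rw [uIcc_of_le hle] at hx
    refine ContinuousAt.mul ?_ (hasDerivAt_ofReal_cpow (hk'.trans_le hx.1) c).continuousAt
    have := continuous_bernoulliFun i
    fun_prop
  rw [hfr, hfr]
  have hd : ∀ x ∈ uIcc (k : ℝ) (k + 1 : ℕ), HasDerivAt
      (fun x : ℝ => (((bernoulliFun (j + 1) (x - k) / (j + 1) : ℝ)) : ℂ) * (x : ℂ) ^ (-s - j))
      ((bernoulliFun j (x - k) : ℂ) * (x : ℂ) ^ (-s - j) - (s + j) / (j + 1) *
        ((bernoulliFun (j + 1) (x - k) : ℂ) * (x : ℂ) ^ (-s - (j + 1 : ℕ)))) x := by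
    intro x hx
    rw [uIcc_of_le hle] at hx
    have d1 := ((antideriv_bernoulliFun j (x - k)).comp_sub_const x (k : ℝ)).ofReal_comp
    have d2 := hasDerivAt_ofReal_cpow (hk'.trans_le hx.1) (-s - j)
    refine (d1.mul d2).congr_deriv ?_
    have : -s - (j : ℂ) - 1 = -s - (j + 1 : ℕ) := by push_cast; ring
    rw [this]
    push_cast
    ring
  rw [← intervalIntegral.integral_const_mul, ← intervalIntegral.integral_sub (hc _ _)
    ((hc _ _).const_mul _), intervalIntegral.integral_eq_sub_of_hasDerivAt hd
    ((hc _ _).sub ((hc _ _).const_mul _))]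
  push_cast
  rw [add_sub_cancel_left, sub_self]
  ring

theorem tendsto_sum_integral_bernoulli (j : ℕ) {m : ℕ} (hm : 1 ≤ m) {s : ℂ}
    (hs : 1 < s.re + j) :
    Tendsto (fun n : ℕ => ∑ k ∈ Finset.Ico m (m + n), ∫ x in (k : ℝ)..(k + 1 : ℕ),
      (bernoulliFun j (Int.fract x) : ℂ) * (x : ℂ) ^ (-s - j)) atTop
      (𝓝 (bernoulliIntegral j m s)) := by
  have hi := integrableOn_bernoulli_integrand j hm hs
  have hm' : (0 : ℝ) < m := by exact_mod_cast hm
  have ht : Tendsto (fun n : ℕ => ((m + n : ℕ) : ℝ)) atTop atTop :=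
    tendsto_natCast_atTop_atTop.comp (tendsto_atTop_mono (fun n => Nat.le_add_left n m) tendsto_id)
  refine (intervalIntegral_tendsto_integral_Ioi (m : ℝ) hi ht).congr fun n => ?_
  rw [intervalIntegral.sum_integral_adjacent_intervals_Ico (a := fun k : ℕ => (k : ℝ)) (by omega)]
  intro k hk
  rw [intervalIntegrable_iff_integrableOn_Ioc_of_le (by push_cast; linarith)]
  refine hi.mono_set fun x hx => lt_of_le_of_lt ?_ hx.1
  exact_mod_cast hk.1

theorem tendsto_sum_Ico_cpow {s : ℂ} (hs : 1 < s.re) (m : ℕ) :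
    Tendsto (fun n : ℕ => ∑ k ∈ Finset.Ico m (m + n), ((k + 1 : ℕ) : ℂ) ^ (-s)) atTop
      (𝓝 (riemannZeta s - ∑ n ∈ Finset.Icc 1 m, 1 / (n : ℂ) ^ s)) := by
  have hsum : Summable fun n : ℕ => 1 / (n + 1 : ℂ) ^ s := by
    have := (summable_nat_add_iff 1).2 (Complex.summable_one_div_nat_cpow.2 hs)
    simpa using this
  have ht : Tendsto (fun n : ℕ => m + n) atTop atTop :=
    tendsto_atTop_mono (fun n => Nat.le_add_left n m) tendsto_id
  have h := (hsum.hasSum.tendsto_sum_nat.comp ht).sub_const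
    (∑ n ∈ Finset.Icc 1 m, 1 / (n : ℂ) ^ s)
  rw [← zeta_eq_tsum_one_div_nat_add_one_cpow hs] at h
  refine h.congr fun n => ?_
  have e : ∑ n ∈ Finset.Icc 1 m, 1 / (n : ℂ) ^ s = ∑ k ∈ Finset.range m, 1 / (k + 1 : ℂ) ^ s := by
    rw [← Finset.Ico_succ_right_eq_Icc, Finset.sum_Ico_eq_sum_range]
    refine Finset.sum_congr (by simp) fun k _ => ?_
    push_cast
    rw [add_comm]
  rw [e, Function.comp_apply, ← Finset.sum_range_add_sum_Ico _ (Nat.le_add_right m n),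
    add_sub_cancel_left]
  refine Finset.sum_congr rfl fun k _ => ?_
  rw [Complex.cpow_neg, one_div]
  push_cast
  rfl

theorem tendsto_natCast_add_cpow {s : ℂ} (hs : 0 < s.re) (m : ℕ) :
    Tendsto (fun n : ℕ => ((m + n : ℕ) : ℂ) ^ (-s)) atTop (𝓝 0) := by
  have ht : Tendsto (fun n : ℕ => ((m + n : ℕ) : ℝ)) atTop atTop :=
    tendsto_natCast_atTop_atTop.comp (tendsto_atTop_mono (fun n => Nat.le_add_left n m) tendsto_id)
  rw [tendsto_zero_iff_norm_tendsto_zero]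
  refine ((tendsto_rpow_neg_atTop hs).comp ht).congr' ?_
  filter_upwards [eventually_ge_atTop 1] with n hn
  rw [norm_natCast_cpow (by omega)]
  rfl

/-- Summing the unit-interval identities over k ≥ m telescopes the boundary terms when B_{j+1}(0) =
B_{j+1}(1). This fails only for j = 0, where the jump 1 of B₁ at each k + 1 leaves the tail ∑_{k >
m} k^{-s} of ζ(s). -/
theorem bernoulliIntegral_sub (j : ℕ) {m : ℕ} (hm : 1 ≤ m) {s : ℂ} (hs : 1 < s.re) :
    bernoulliIntegral j m s - (s + j) / (j + 1) * bernoulliIntegral (j + 1) m s =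
      (-(bernoulliFun (j + 1) 0 * (m : ℂ) ^ (-s - j)) + if j = 0 then
        riemannZeta s - ∑ n ∈ Finset.Icc 1 m, 1 / (n : ℂ) ^ s else 0) / (j + 1) := by
  have hj : (0 : ℝ) ≤ j := j.cast_nonneg
  have h1 := tendsto_sum_integral_bernoulli j hm (s := s) (by linarith)
  have h2 := tendsto_sum_integral_bernoulli (j + 1) hm (s := s) (by push_cast; linarith)
  have h3 := h1.sub (h2.const_mul ((s + j) / (j + 1)))
  refine tendsto_nhds_unique h3 ?_
  have e : ∀ n : ℕ, (∑ k ∈ Finset.Ico m (m + n), (∫ x in (k : ℝ)..(k + 1 : ℕ),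
      (bernoulliFun j (Int.fract x) : ℂ) * (x : ℂ) ^ (-s - j))) - (s + j) / (j + 1) *
      (∑ k ∈ Finset.Ico m (m + n), ∫ x in (k : ℝ)..(k + 1 : ℕ),
        (bernoulliFun (j + 1) (Int.fract x) : ℂ) * (x : ℂ) ^ (-s - (j + 1 : ℕ))) =
      (bernoulliFun (j + 1) 0 * (((m + n : ℕ) : ℂ) ^ (-s - j) - (m : ℂ) ^ (-s - j)) +
        if j = 0 then ∑ k ∈ Finset.Ico m (m + n), ((k + 1 : ℕ) : ℂ) ^ (-s) else 0) / (j + 1) := by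
    intro n
    have htel : ((m + n : ℕ) : ℂ) ^ (-s - j) - (m : ℂ) ^ (-s - j) = ∑ k ∈ Finset.Ico m (m + n),
        (((k + 1 : ℕ) : ℂ) ^ (-s - j) - (k : ℂ) ^ (-s - j)) := by
      exact (Finset.sum_Ico_sub (fun k : ℕ => (k : ℂ) ^ (-s - j)) (Nat.le_add_right m n)).symm
    rw [Finset.mul_sum, ← Finset.sum_sub_distrib, Finset.sum_congr rfl fun k hk =>
      integral_bernoulli_unit j (hm.trans (Finset.mem_Ico.1 hk).1) s, ← Finset.sum_div]
    congr 1
    rw [htel,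
      Finset.mul_sum, bernoulliFun_eval_one]
    split_ifs with h1 h2 h2
    · rw [← Finset.sum_add_distrib]
      refine Finset.sum_congr rfl fun k _ => ?_
      rw [h2]
      push_cast
      rw [sub_zero]
      ring
    · omega
    · omega
    · rw [add_zero, add_zero]
      refine Finset.sum_congr rfl fun k _ => ?_
      rw [mul_sub]
  simp_rw [e]
  refine Tendsto.div_const (Tendsto.add ?_ ?_) _
  · have := ((tendsto_natCast_add_cpow (s := s + j) (by simp; linarith) m).sub_const
      ((m : ℂ) ^ (-s - j))).const_mul (bernoulliFun (j + 1) 0 : ℂ)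
    rw [zero_sub, mul_neg] at this
    refine this.congr fun n => ?_
    rw [neg_add']
  · split_ifs
    · exact tendsto_sum_Ico_cpow hs m
    · exact tendsto_const_nhds

/-- The coefficient of the remainder integral in the Euler–Maclaurin formula. -/
noncomputable def emCoeff (j : ℕ) (s : ℂ) : ℂ :=
  -∏ i ∈ Finset.range j, (s + i) / (i + 1)

theorem differentiable_emCoeff (j : ℕ) : Differentiable ℂ (emCoeff j) := by
  unfold emCoeff
  fun_prop

theorem bernoulliIntegral_zero {m : ℕ} (hm : 1 ≤ m) {s : ℂ} (hs : 1 < s.re) :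
    bernoulliIntegral 0 m s = (m : ℂ) ^ (1 - s) / (s - 1) := by
  have hm' : (0 : ℝ) < m := by exact_mod_cast hm
  simp only [bernoulliIntegral, bernoulliFun_zero, Complex.ofReal_one, one_mul, Nat.cast_zero,
    sub_zero]
  rw [integral_Ioi_cpow_of_lt (by simpa using hs) hm', ← neg_div_neg_eq]
  push_cast
  congr 1
  · ring_nf
  · ring

theorem zetaErr_eq_of_one_lt {J : ℕ} (hJ : 1 ≤ J) {m : ℕ} (hm : 1 ≤ m) {s : ℂ} (hs : 1 < s.re) :
    zetaErr m s = (∑ j ∈ Finset.range J,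
      -(emCoeff j s * bernoulliFun (j + 1) 0 / (j + 1)) * (m : ℂ) ^ (-s - j)) +
      emCoeff J s * bernoulliIntegral J m s := by
  induction J, hJ using Nat.le_induction with
  | base =>
    have h := bernoulliIntegral_sub 0 hm hs
    rw [bernoulliIntegral_zero hm hs] at h
    simp only [Nat.cast_zero, if_true, zero_add, div_one, add_zero] at h
    simp only [zetaErr, emCoeff, Finset.range_one, Finset.sum_singleton, Finset.prod_singleton,
      Finset.range_zero, Finset.prod_empty, Nat.cast_zero, zero_add, div_one, add_zero]
    linear_combination -h
  | succ J hJ ih =>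
    have h := bernoulliIntegral_sub J hm hs
    rw [if_neg (by omega)] at h
    have hq : emCoeff (J + 1) s = emCoeff J s * ((s + J) / (J + 1)) := by
      rw [emCoeff, emCoeff, Finset.prod_range_succ]
      ring
    rw [ih, Finset.sum_range_succ, hq]
    linear_combination emCoeff J s * h

theorem differentiableAt_bernoulliIntegral (j : ℕ) {m : ℕ} (hm : 1 ≤ m) {s : ℂ}
    (hs : 1 < s.re + j) : DifferentiableAt ℂ (bernoulliIntegral j m) s := by
  obtain ⟨B, hB0, hB⟩ := exists_bernoulliFun_fract_le j
  have hm' : (0 : ℝ) < m := by exact_mod_cast hm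
  -- The integral is the Mellin transform of `f` at 1 - s - j. Since `f` is bounded and vanishes
  -- near 0, it is differentiable where Re(1 - s - j) < 0.
  set f : ℝ → ℂ := (Ioi (m : ℝ)).indicator fun x => (bernoulliFun j (Int.fract x) : ℂ) with hf
  have hfm : Measurable f :=
    (Complex.measurable_ofReal.comp (measurable_bernoulliFun_fract j)).indicator measurableSet_Ioi
  have hfb : ∀ x, ‖f x‖ ≤ B := by
    intro x
    rw [hf]
    refine (norm_indicator_le_norm_self _ _).trans ?_
    rw [Complex.norm_real]
    exact hB x
  have hmell : bernoulliIntegral j m = fun s => mellin f (1 - s - j) := by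
    funext s
    have hsub : Ioi (0 : ℝ) ∩ Ioi (m : ℝ) = Ioi (m : ℝ) := by
      rw [Ioi_inter_Ioi, max_eq_right hm'.le]
    rw [mellin, bernoulliIntegral]
    have : ∀ t : ℝ, (t : ℂ) ^ (1 - s - j - 1) • f t = (Ioi (m : ℝ)).indicator (fun x : ℝ =>
        (bernoulliFun j (Int.fract x) : ℂ) * (x : ℂ) ^ (-s - j)) t := by
      intro t
      rw [hf, smul_eq_mul, show 1 - s - (j : ℂ) - 1 = -s - j by ring]
      by_cases ht : t ∈ Ioi (m : ℝ)
      · rw [indicator_of_mem ht, indicator_of_mem ht, mul_comm]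
      · rw [indicator_of_notMem ht, indicator_of_notMem ht, mul_zero]
    simp_rw [this]
    rw [setIntegral_indicator measurableSet_Ioi, hsub]
  rw [hmell]
  have hd : DifferentiableAt ℂ (mellin f) (1 - s - j) := by
    refine mellin_differentiableAt_of_isBigO_rpow (a := 0) (b := (1 - s - j).re - 1)
      ?_ ?_ ?_ ?_ (by linarith)
    · exact ((locallyIntegrable_const B).mono hfm.aestronglyMeasurable (ae_of_all _ fun x => by
        rw [Real.norm_of_nonneg hB0]; exact hfb x)).locallyIntegrableOn _
    · refine Asymptotics.IsBigO.of_bound B (Eventually.of_forall fun x => ?_)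
      simpa using hfb x
    · simp
      linarith
    · have : f =ᶠ[𝓝[>] (0 : ℝ)] fun _ => 0 := by
        have : ∀ᶠ x : ℝ in 𝓝[>] 0, x < m := nhdsWithin_le_nhds (eventually_lt_nhds hm')
        filter_upwards [this] with x hx
        rw [hf, indicator_of_notMem]
        simpa using hx.le
      exact this.trans_isBigO (Asymptotics.isBigO_zero _ _)
  exact hd.comp s (f := fun s => 1 - s - (j : ℂ)) (by fun_prop)

theorem sub_one_mul_zetaErr (m : ℕ) {s : ℂ} (hs : s ≠ 1) :
    (s - 1) * zetaErr m s = riemannZeta₁ s -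
      (s - 1) * ∑ n ∈ Finset.Icc 1 m, 1 / (n : ℂ) ^ s - (m : ℂ) ^ (1 - s) := by
  have : s - 1 ≠ 0 := sub_ne_zero.2 hs
  rw [zetaErr, riemannZeta_eq_inv_sub_mul hs]
  field_simp

theorem differentiable_sum_one_div_cpow (m : ℕ) :
    Differentiable ℂ fun s : ℂ => ∑ n ∈ Finset.Icc 1 m, 1 / (n : ℂ) ^ s := by
  refine Differentiable.fun_sum fun n hn => ?_
  have hn0 : (n : ℂ) ≠ 0 := by
    have := (Finset.mem_Icc.1 hn).1
    exact_mod_cast (by omega : n ≠ 0)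
  intro s
  refine DifferentiableAt.div (by fun_prop) (DifferentiableAt.const_cpow (by fun_prop) (Or.inl hn0)) ?_
  simp [Complex.cpow_eq_zero_iff, hn0]

/-- Analytic continuation from Re s > 1 to Re s > 1 - J. Both sides are multiplied by s - 1 so that
the identity theorem applies on a convex half-plane, without a puncture at s = 1. -/
theorem zetaErr_eq {J : ℕ} (hJ : 1 ≤ J) {m : ℕ} (hm : 1 ≤ m) {s : ℂ} (hs : 1 < s.re + J)
    (hs1 : s ≠ 1) :
    zetaErr m s = (∑ j ∈ Finset.range J,
      -(emCoeff j s * bernoulliFun (j + 1) 0 / (j + 1)) * (m : ℂ) ^ (-s - j)) +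
      emCoeff J s * bernoulliIntegral J m s := by
  have hm0 : (m : ℂ) ≠ 0 := by exact_mod_cast (by omega : m ≠ 0)
  set U : Set ℂ := {s | 1 - (J : ℝ) < s.re} with hU
  have hUo : IsOpen U := isOpen_lt continuous_const Complex.continuous_re
  have hUc : Convex ℝ U := convex_halfSpace_re_gt _
  set R : ℂ → ℂ := fun s => (∑ j ∈ Finset.range J,
      -(emCoeff j s * bernoulliFun (j + 1) 0 / (j + 1)) * (m : ℂ) ^ (-s - j)) +
      emCoeff J s * bernoulliIntegral J m s with hR
  set G : ℂ → ℂ := fun s => riemannZeta₁ s -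
      (s - 1) * ∑ n ∈ Finset.Icc 1 m, 1 / (n : ℂ) ^ s - (m : ℂ) ^ (1 - s) with hG
  have hcp : ∀ f : ℂ → ℂ, Differentiable ℂ f → Differentiable ℂ fun s => (m : ℂ) ^ f s :=
    fun f hf s => (hf s).const_cpow (Or.inl hm0)
  have hGd : DifferentiableOn ℂ G U := by
    refine Differentiable.differentiableOn ?_
    have h1 := differentiable_sum_one_div_cpow m
    have h2 := hcp (fun s => 1 - s) (by fun_prop)
    exact (differentiable_riemannZeta₁.sub ((by fun_prop : Differentiable ℂ
      fun s : ℂ => s - 1).mul h1)).sub h2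
  have hRd : DifferentiableOn ℂ (fun s => (s - 1) * R s) U := by
    intro s hs
    refine (DifferentiableAt.mul (by fun_prop) ?_).differentiableWithinAt
    refine DifferentiableAt.add ?_ ?_
    · refine DifferentiableAt.fun_sum fun j _ => ?_
      have h1 := differentiable_emCoeff j s
      have h2 := hcp (fun s => -s - j) (by fun_prop) s
      exact DifferentiableAt.mul (by fun_prop) h2
    · refine (differentiable_emCoeff J s).mul (differentiableAt_bernoulliIntegral J hm ?_)
      have : 1 - (J : ℝ) < s.re := hs
      linarith
  have h2U : (2 : ℂ) ∈ U := by
    have : (1 : ℝ) ≤ J := by exact_mod_cast hJ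
    simp [hU]
    linarith
  have heq : EqOn G (fun s => (s - 1) * R s) U := by
    refine (hGd.analyticOnNhd hUo).eqOn_of_preconnected_of_eventuallyEq (hRd.analyticOnNhd hUo)
      hUc.isPreconnected h2U ?_
    have : ∀ᶠ s : ℂ in 𝓝 2, 1 < s.re :=
      (isOpen_lt continuous_const Complex.continuous_re).mem_nhds (by simp)
    filter_upwards [this] with s hs
    have hs1 : s ≠ 1 := by rintro rfl; simp at hs
    simp only [hR, hG]
    rw [← zetaErr_eq_of_one_lt hJ hm hs, sub_one_mul_zetaErr m hs1]
  have := heq (show s ∈ U by simp only [hU, mem_ofPred_eq]; linarith)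
  simp only [hG] at this
  rw [← sub_one_mul_zetaErr m hs1] at this
  exact mul_left_cancel₀ (sub_ne_zero.2 hs1) this

/-- `ζ(s) - ∑_{n ≤ m} n^{-s} = m^{1-s} / (s - 1) + O(m^{-Re s})`, locally uniformly in `s`. -/
theorem exists_norm_zetaErr_le (J : ℕ) : ∃ B : ℂ → ℝ, Continuous B ∧ ∀ s : ℂ, s ≠ 1 →
    -(J : ℝ) < s.re → ∀ m : ℕ, 1 ≤ m → ‖zetaErr m s‖ ≤ B s * (m : ℝ) ^ (-s.re) := by
  -- Going up to order J + 2 makes the denominator Re s + (J + 2) - 1 of the integral bound at least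
  -- 1, which keeps the constant continuous in s.
  obtain ⟨b, hb0, hb⟩ := exists_bernoulliFun_fract_le (J + 2)
  refine ⟨fun s => ∑ j ∈ Finset.range (J + 2),
    ‖-(emCoeff j s * bernoulliFun (j + 1) 0 / (j + 1))‖ + ‖emCoeff (J + 2) s‖ * b, ?_, ?_⟩
  · have : ∀ j, Continuous (emCoeff j) := fun j => (differentiable_emCoeff j).continuous
    fun_prop
  intro s hs1 hs m hm
  have hm1 : (1 : ℝ) ≤ m := by exact_mod_cast hm
  rw [zetaErr_eq (J := J + 2) (by omega) hm (by push_cast; linarith) hs1, add_mul, Finset.sum_mul]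
  refine (norm_add_le _ _).trans (add_le_add ((norm_sum_le _ _).trans
    (Finset.sum_le_sum fun j _ => ?_)) ?_)
  · rw [norm_mul, norm_natCast_cpow hm]
    refine mul_le_mul_of_nonneg_left (Real.rpow_le_rpow_of_exponent_le hm1 ?_) (norm_nonneg _)
    simp
  · rw [norm_mul, mul_assoc]
    refine mul_le_mul_of_nonneg_left ?_ (norm_nonneg _)
    refine (norm_bernoulliIntegral_le hb hm (by push_cast; linarith)).trans ?_
    refine mul_le_mul_of_nonneg_left ?_ hb0
    have hden : 1 ≤ s.re + (J + 2 : ℕ) - 1 := by push_cast; linarith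
    refine (div_le_self (by positivity) hden).trans
      (Real.rpow_le_rpow_of_exponent_le hm1 ?_)
    push_cast
    linarith [J.cast_nonneg (α := ℝ)]

/-! ### The remainder for arguments of height comparable to the length of the sum -/

/-- The entire function `(e^y - 1) / y`. -/
noncomputable def expQuot : ℂ → ℂ := dslope Complex.exp 0

theorem mul_expQuot (y : ℂ) : y * expQuot y = Complex.exp y - 1 := by
  simpa [expQuot] using sub_smul_dslope Complex.exp 0 y

theorem expQuot_zero : expQuot 0 = 1 := by
  simp [expQuot]

theorem analyticAt_expQuot (y : ℂ) : AnalyticAt ℂ expQuot y := by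
  have : Differentiable ℂ expQuot := by
    rw [← differentiableOn_univ]
    exact (Complex.differentiableOn_dslope univ_mem).2 Complex.differentiable_exp.differentiableOn
  exact this.analyticAt y

/-- The quotient is analytic near the origin, hence Lipschitz there; its value at the origin is 1.
It is the factor comparing n^{z-1} with an increment of n^z / z. -/
theorem exists_lipschitz_expQuot : ∃ r > 0, ∃ K : ℝ, 0 ≤ K ∧
    (∀ y : ℂ, ‖y‖ < r → expQuot y ≠ 0) ∧
    ∀ p q : ℂ × ℂ, ‖p‖ < r → ‖q‖ < r →
      ‖(expQuot p.1)⁻¹ * expQuot p.2 - (expQuot q.1)⁻¹ * expQuot q.2‖ ≤ K * ‖p - q‖ := by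
  have hne : ∀ᶠ y : ℂ in 𝓝 0, expQuot y ≠ 0 :=
    (analyticAt_expQuot 0).continuousAt.eventually_ne (by simp [expQuot_zero])
  have hc : ContDiffAt ℂ 1 (fun p : ℂ × ℂ => (expQuot p.1)⁻¹ * expQuot p.2) (0, 0) := by
    refine AnalyticAt.contDiffAt ?_
    refine AnalyticAt.mul (AnalyticAt.inv ?_ (by simp [expQuot_zero])) ?_
    · exact (analyticAt_expQuot 0).comp (f := Prod.fst) (x := ((0 : ℂ), (0 : ℂ))) analyticAt_fst
    · exact (analyticAt_expQuot 0).comp (f := Prod.snd) (x := ((0 : ℂ), (0 : ℂ))) analyticAt_snd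
  obtain ⟨K, t, ht, hK⟩ := hc.exists_lipschitzOnWith
  obtain ⟨r₁, hr₁, h₁⟩ := Metric.eventually_nhds_iff.1 hne
  obtain ⟨r₂, hr₂, h₂⟩ := Metric.mem_nhds_iff.1 ht
  refine ⟨min r₁ r₂, lt_min hr₁ hr₂, K, K.2, fun y hy => h₁ ?_, fun p q hp hq => ?_⟩
  · simpa using hy.trans_le (min_le_left _ _)
  · have hp' : p ∈ t := h₂ (mem_ball_iff_norm.2 (by
      rw [Prod.mk_zero_zero, sub_zero]; exact hp.trans_le (min_le_right _ _)))
    have hq' : q ∈ t := h₂ (mem_ball_iff_norm.2 (by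
      rw [Prod.mk_zero_zero, sub_zero]; exact hq.trans_le (min_le_right _ _)))
    simpa [dist_eq_norm] using hK.dist_le_mul p hp' q hq'

theorem natCast_cpow_eq_exp {n : ℕ} (hn : 1 ≤ n) (z : ℂ) :
    (n : ℂ) ^ z = Complex.exp (Real.log n * z) := by
  have : (n : ℂ) ≠ 0 := by exact_mod_cast (by omega : n ≠ 0)
  rw [Complex.cpow_def_of_ne_zero this, Complex.natCast_log]

/-- `log (1 + 1 / n)`. -/
noncomputable def logStep (n : ℕ) : ℝ := Real.log (n + 1 : ℕ) - Real.log n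

theorem logStep_bounds {n : ℕ} (hn : 1 ≤ n) : 0 < logStep n ∧ logStep n ≤ 1 / n := by
  have hn0 : (0 : ℝ) < n := by exact_mod_cast hn
  have hn1 : (0 : ℝ) < (n + 1 : ℕ) := by positivity
  constructor
  · exact sub_pos.2 (Real.log_lt_log hn0 (by push_cast; linarith))
  · have := Real.log_le_sub_one_of_pos (div_pos hn1 hn0)
    rw [Real.log_div hn1.ne' hn0.ne'] at this
    refine this.trans_eq ?_
    push_cast
    field_simp
    ring

theorem abs_logStep_sub_le {n : ℕ} (hn : 1 ≤ n) :
    |logStep (n + 1) - logStep n| ≤ 1 / (n : ℝ) ^ 2 := by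
  have hn0 : (0 : ℝ) < n := by exact_mod_cast hn
  have h1 : (0 : ℝ) < (n + 1 : ℕ) := by positivity
  have h2 : (0 : ℝ) < (n + 1 + 1 : ℕ) := by positivity
  have e : logStep n - logStep (n + 1) =
      Real.log (((n + 1 : ℕ) : ℝ) * (n + 1 : ℕ) / (n * (n + 1 + 1 : ℕ))) := by
    rw [Real.log_div (by positivity) (by positivity), Real.log_mul h1.ne' h1.ne',
      Real.log_mul hn0.ne' h2.ne', logStep, logStep]
    ring
  have hq : (1 : ℝ) ≤ ((n + 1 : ℕ) : ℝ) * (n + 1 : ℕ) / (n * (n + 1 + 1 : ℕ)) := by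
    rw [one_le_div (by positivity)]
    push_cast
    nlinarith
  rw [abs_sub_comm, e, abs_of_nonneg (Real.log_nonneg hq)]
  refine (Real.log_le_sub_one_of_pos (by linarith)).trans ?_
  rw [div_sub_one (by positivity), div_le_div_iff₀ (by positivity) (by positivity)]
  push_cast
  nlinarith

/-- With L = log(1 + 1/n), the increment of n^z / z is n^z (e^{zL} - 1)/z, while n^{z-1} = n^z (e^L
- 1); dividing out L leaves the two values of `expQuot`. -/
theorem cpow_sub_one_eq {z : ℂ} (hz : z ≠ 0) {n : ℕ} (hn : 1 ≤ n)
    (h : expQuot (z * logStep n) ≠ 0) :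
    (n : ℂ) ^ (z - 1) = (((n + 1 : ℕ) : ℂ) ^ z / z - (n : ℂ) ^ z / z) *
      ((expQuot (z * logStep n))⁻¹ * expQuot (logStep n)) := by
  have hn0 : (n : ℂ) ≠ 0 := by exact_mod_cast (by omega : n ≠ 0)
  have hn0' : (0 : ℝ) < n := by exact_mod_cast hn
  have e1 : ((n + 1 : ℕ) : ℂ) ^ z = (n : ℂ) ^ z * Complex.exp (z * logStep n) := by
    rw [natCast_cpow_eq_exp hn, natCast_cpow_eq_exp (by omega), ← Complex.exp_add, logStep]
    congr 1
    push_cast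
    ring
  have e2 : (logStep n : ℂ) * expQuot (logStep n) = 1 / n := by
    rw [mul_expQuot, ← Complex.ofReal_exp, logStep, Real.exp_sub, Real.exp_log hn0',
      Real.exp_log (by positivity)]
    push_cast
    field_simp
    ring
  have e3 := mul_expQuot (z * logStep n)
  rw [Complex.cpow_sub _ _ hn0, Complex.cpow_one, e1]
  have e4 : Complex.exp (z * logStep n) = z * logStep n * expQuot (z * logStep n) + 1 := by
    rw [e3]; ring
  rw [e4, div_eq_mul_one_div, ← e2]
  generalize expQuot (z * logStep n) = a at h ⊢
  field_simp
  ring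

theorem sum_Ico_mul_by_parts (E P : ℕ → ℂ) {N M : ℕ} (h : N ≤ M) :
    ∑ n ∈ Finset.Ico N M, (E (n + 1) - E n) * (P n - 1) =
      E M * (P M - 1) - E N * (P N - 1) -
        ∑ n ∈ Finset.Ico N M, E (n + 1) * (P (n + 1) - P n) := by
  induction M, h using Nat.le_induction with
  | base => simp
  | succ M h ih =>
    rw [Finset.sum_Ico_succ_top h, Finset.sum_Ico_succ_top h, ih]
    ring

/-- Write n^{z-1} = (E_{n+1} - E_n) P_n with E_n = n^z / z. For n large against 1 + |z|, P_n is 1 +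
O((1+|z|)/n) and its increments are O((1+|z|)/n²). Abel summation then gains the oscillation of n^z,
which yields a bound uniform in z. -/
theorem exists_norm_sum_Ico_cpow_sub_le {σ : ℝ} (hσ : 0 < σ) : ∃ κ > 0, ∃ C : ℝ, 0 ≤ C ∧
    ∀ (z : ℂ) (N M : ℕ), z ≠ 0 → z.re = 1 - σ → 1 ≤ N → N ≤ M → κ * (1 + ‖z‖) ≤ N →
      ‖∑ n ∈ Finset.Ico N M, (n : ℂ) ^ (z - 1) - ((M : ℂ) ^ z / z - (N : ℂ) ^ z / z)‖ ≤
        C * (1 + 1 / ‖z‖) * (N : ℝ) ^ (-σ) := by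
  obtain ⟨r, hr, K, hK, hne, hlip⟩ := exists_lipschitz_expQuot
  -- The choice 2/r puts all arguments of the Lipschitz quotient within r/2 of the origin. The 2
  -- counts the boundary terms of Abel summation; the 4 comes from 1/n² ≤ 4/(n+1)².
  refine ⟨2 / r, by positivity, K * (2 + 4 / σ), by positivity, fun z N M hz hzσ hN hNM hκ => ?_⟩
  have hz0 : 0 < ‖z‖ := norm_pos_iff.2 hz
  have hN0 : (0 : ℝ) < N := by exact_mod_cast hN
  set p : ℕ → ℂ × ℂ := fun n => (z * logStep n, (logStep n : ℂ)) with hp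
  set P : ℕ → ℂ := fun n => (expQuot (p n).1)⁻¹ * expQuot (p n).2 with hP
  set E : ℕ → ℂ := fun n => (n : ℂ) ^ z / z with hE
  have hpair : ∀ x : ℝ, ‖((z * x, (x : ℂ)) : ℂ × ℂ)‖ ≤ (1 + ‖z‖) * |x| := by
    intro x
    rw [Prod.norm_def]
    simp only [norm_mul, Complex.norm_real, Real.norm_eq_abs]
    have := abs_nonneg x
    refine max_le ?_ ?_ <;> nlinarith
  have hpn : ∀ n, 1 ≤ n → ‖p n‖ ≤ (1 + ‖z‖) * (1 / n) := by
    intro n hn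
    refine (hpair _).trans (mul_le_mul_of_nonneg_left ?_ (by positivity))
    rw [abs_of_pos (logStep_bounds hn).1]
    exact (logStep_bounds hn).2
  have hpr : ∀ n, N ≤ n → ‖p n‖ < r := by
    intro n hn
    have hn0 : (0 : ℝ) < n := by exact_mod_cast hN.trans hn
    have hNn : (N : ℝ) ≤ n := by exact_mod_cast hn
    refine (hpn n (hN.trans hn)).trans_lt ?_
    rw [mul_one_div, div_lt_iff₀ hn0]
    rw [div_mul_eq_mul_div, div_le_iff₀ hr] at hκ
    nlinarith
  have hP1 : ∀ n, N ≤ n → ‖P n - 1‖ ≤ K * (1 + ‖z‖) * (1 / n) := by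
    intro n hn
    have := hlip (p n) 0 (hpr n hn) (by simpa using hr)
    simp only [Prod.fst_zero, Prod.snd_zero, expQuot_zero, inv_one, mul_one, sub_zero] at this
    refine this.trans ?_
    rw [mul_assoc]
    exact mul_le_mul_of_nonneg_left (hpn n (hN.trans hn)) hK
  have hP2 : ∀ n, N ≤ n → ‖P (n + 1) - P n‖ ≤ K * (1 + ‖z‖) * (1 / (n : ℝ) ^ 2) := by
    intro n hn
    refine (hlip (p (n + 1)) (p n) (hpr _ (by omega)) (hpr n hn)).trans ?_
    rw [mul_assoc]
    refine mul_le_mul_of_nonneg_left ?_ hK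
    have : p (n + 1) - p n = (z * (logStep (n + 1) - logStep n : ℝ),
        ((logStep (n + 1) - logStep n : ℝ) : ℂ)) := by
      simp only [hp, Prod.mk_sub_mk]
      push_cast
      rw [mul_sub]
    rw [this]
    exact (hpair _).trans (mul_le_mul_of_nonneg_left (abs_logStep_sub_le (hN.trans hn))
      (by positivity))
  have hEn : ∀ n, 1 ≤ n → ‖E n‖ = (n : ℝ) ^ (1 - σ) / ‖z‖ := by
    intro n hn
    rw [hE, norm_div, norm_natCast_cpow hn, hzσ]
  have hterm : ∀ n ∈ Finset.Ico N M, (n : ℂ) ^ (z - 1) - (E (n + 1) - E n) =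
      (E (n + 1) - E n) * (P n - 1) := by
    intro n hn
    have hn' := (Finset.mem_Ico.1 hn).1
    have := cpow_sub_one_eq hz (hN.trans hn')
      (hne _ ((norm_fst_le (p n)).trans_lt (hpr n hn')))
    rw [this]
    simp only [hE, hP, hp]
    ring
  have htel : (M : ℂ) ^ z / z - (N : ℂ) ^ z / z = ∑ n ∈ Finset.Ico N M, (E (n + 1) - E n) :=
    (Finset.sum_Ico_sub E hNM).symm
  have hbd : ∀ n, N ≤ n → ‖E n * (P n - 1)‖ ≤ K * ((1 + ‖z‖) / ‖z‖) * (N : ℝ) ^ (-σ) := by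
    intro n hn
    have hn0 : (0 : ℝ) < n := by exact_mod_cast hN.trans hn
    have hNn : (N : ℝ) ≤ n := by exact_mod_cast hn
    rw [norm_mul, hEn n (hN.trans hn)]
    calc (n : ℝ) ^ (1 - σ) / ‖z‖ * ‖P n - 1‖
        ≤ (n : ℝ) ^ (1 - σ) / ‖z‖ * (K * (1 + ‖z‖) * (1 / n)) := by
          gcongr
          exact hP1 n hn
      _ = K * ((1 + ‖z‖) / ‖z‖) * (n : ℝ) ^ (-σ) := by
          rw [show -σ = (1 - σ) - 1 by ring, Real.rpow_sub_one hn0.ne']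
          ring
      _ ≤ _ := by
          refine mul_le_mul_of_nonneg_left ?_ (by positivity)
          exact Real.rpow_le_rpow_of_nonpos hN0 hNn (by linarith)
  have hsumbd : ‖∑ n ∈ Finset.Ico N M, E (n + 1) * (P (n + 1) - P n)‖ ≤
      K * ((1 + ‖z‖) / ‖z‖) * (4 * ((N : ℝ) ^ (-σ) / σ)) := by
    have h1 : ∀ n ∈ Finset.Ico N M, ‖E (n + 1) * (P (n + 1) - P n)‖ ≤
        K * ((1 + ‖z‖) / ‖z‖) * (4 * ((n : ℝ) + 1) ^ (-(σ + 1))) := by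
      intro n hn
      have hn' := (Finset.mem_Ico.1 hn).1
      have hn1 : (1 : ℝ) ≤ n := by exact_mod_cast hN.trans hn'
      have hn0 : (0 : ℝ) < (n : ℝ) + 1 := by positivity
      rw [norm_mul, hEn _ (by omega)]
      push_cast
      calc ((n : ℝ) + 1) ^ (1 - σ) / ‖z‖ * ‖P (n + 1) - P n‖
          ≤ ((n : ℝ) + 1) ^ (1 - σ) / ‖z‖ * (K * (1 + ‖z‖) * (4 / ((n : ℝ) + 1) ^ 2)) := by
            have : 1 / (n : ℝ) ^ 2 ≤ 4 / ((n : ℝ) + 1) ^ 2 := by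
              rw [div_le_div_iff₀ (by positivity) (by positivity)]
              nlinarith
            gcongr
            exact (hP2 n hn').trans (mul_le_mul_of_nonneg_left this (by positivity))
        _ = _ := by
            rw [show -(σ + 1) = (1 - σ) - (2 : ℕ) by push_cast; ring, Real.rpow_sub_natCast hn0.ne']
            ring
    refine (norm_sum_le _ _).trans ((Finset.sum_le_sum h1).trans ?_)
    rw [← Finset.mul_sum, ← Finset.mul_sum]
    refine mul_le_mul_of_nonneg_left (mul_le_mul_of_nonneg_left ?_ (by norm_num)) (by positivity)
    have := sum_range_rpow_le hσ hN (M - N)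
    rw [Finset.sum_Ico_eq_sum_range]
    push_cast
    exact this
  rw [htel, ← Finset.sum_sub_distrib, Finset.sum_congr rfl hterm, sum_Ico_mul_by_parts E P hNM]
  refine (norm_sub_le _ _).trans ?_
  have h3 := norm_sub_le (E M * (P M - 1)) (E N * (P N - 1))
  have h4 := hbd M hNM
  have h5 := hbd N le_rfl
  have h6 : (1 + ‖z‖) / ‖z‖ = 1 + 1 / ‖z‖ := by field_simp; ring
  rw [h6] at h4 h5 hsumbd
  have h7 : K * (2 + 4 / σ) * (1 + 1 / ‖z‖) * (N : ℝ) ^ (-σ) =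
      K * (1 + 1 / ‖z‖) * (N : ℝ) ^ (-σ) + K * (1 + 1 / ‖z‖) * (N : ℝ) ^ (-σ) +
      K * (1 + 1 / ‖z‖) * (4 * ((N : ℝ) ^ (-σ) / σ)) := by ring
  linarith

/-- `ζ(w) = ∑_{n ≤ N} n^{-w} + N^{1-w} / (w - 1) + O(N^{-σ})` on the line `Re w = σ > 0`, uniformly
for `|w| ≪ N`. -/
theorem exists_norm_zetaErr_le_of_height_le {σ : ℝ} (hσ : 0 < σ) : ∃ κ > 0, ∃ C : ℝ, 0 ≤ C ∧
    ∀ (w : ℂ) (N : ℕ), w ≠ 1 → w.re = σ → 1 ≤ N → κ * (1 + ‖1 - w‖) ≤ N →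
      ‖zetaErr N w‖ ≤ C * (1 + 1 / ‖1 - w‖) * (N : ℝ) ^ (-σ) := by
  obtain ⟨κ, hκ, C, hC, h⟩ := exists_norm_sum_Ico_cpow_sub_le hσ
  obtain ⟨B, -, hB⟩ := exists_norm_zetaErr_le 0
  refine ⟨κ, hκ, C + 2, by positivity, fun w N hw hwσ hN hκN => ?_⟩
  have hz : 1 - w ≠ 0 := sub_ne_zero.2 (Ne.symm hw)
  have hN0 : (0 : ℝ) < N := by exact_mod_cast hN
  -- The non-uniform factor B w is harmless: it multiplies M^{-σ}, which tends to 0 as M → ∞ with w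
  -- and N fixed.
  have hb : ∀ M : ℕ, N ≤ M → ‖zetaErr N w‖ ≤ B w * (M : ℝ) ^ (-σ) +
      (C + 2) * (1 + 1 / ‖1 - w‖) * (N : ℝ) ^ (-σ) := by
    intro M hM
    have hNM : (N : ℝ) ≤ M := by exact_mod_cast hM
    have h1 := h (1 - w) N M hz (by simp [hwσ]) hN hM hκN
    have h2 := hB w hw (by simp [hwσ, hσ]) M (hN.trans hM)
    rw [hwσ] at h2
    have e1 : ∀ n : ℕ, (n : ℂ) ^ (1 - w - 1) = 1 / (n : ℂ) ^ w := by
      intro n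
      rw [show 1 - w - 1 = -w by ring, Complex.cpow_neg, one_div]
    simp_rw [e1] at h1
    -- The sum over N < n ≤ M differs from the one over N ≤ n < M by two endpoint terms, each
    -- O(N^{-σ}); they account for the 2 in C + 2.
    have e2 : ∑ n ∈ Finset.Icc 1 M, 1 / (n : ℂ) ^ w = ∑ n ∈ Finset.Icc 1 N, 1 / (n : ℂ) ^ w +
        (∑ n ∈ Finset.Ico N M, 1 / (n : ℂ) ^ w + 1 / (M : ℂ) ^ w - 1 / (N : ℂ) ^ w) := by
      have a1 := Finset.sum_Ico_consecutive (fun n : ℕ => 1 / (n : ℂ) ^ w) hN hM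
      have a2 := Finset.sum_Ico_succ_top hN (fun n : ℕ => 1 / (n : ℂ) ^ w)
      have a3 := Finset.sum_Ico_succ_top (hN.trans hM) (fun n : ℕ => 1 / (n : ℂ) ^ w)
      rw [← Finset.Ico_succ_right_eq_Icc, ← Finset.Ico_succ_right_eq_Icc]
      simp only [Order.succ_eq_add_one]
      rw [a2, a3, ← a1]
      ring
    have e3 : zetaErr N w = zetaErr M w + (∑ n ∈ Finset.Ico N M, 1 / (n : ℂ) ^ w -
        ((M : ℂ) ^ (1 - w) / (1 - w) - (N : ℂ) ^ (1 - w) / (1 - w))) +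
        (1 / (M : ℂ) ^ w - 1 / (N : ℂ) ^ w) := by
      rw [zetaErr, zetaErr, e2, ← neg_sub 1 w, div_neg, div_neg]
      ring
    have e4 : ∀ n : ℕ, 1 ≤ n → ‖1 / (n : ℂ) ^ w‖ = (n : ℝ) ^ (-σ) := by
      intro n hn
      rw [one_div, ← Complex.cpow_neg, norm_natCast_cpow hn, Complex.neg_re, hwσ]
    have h3 := norm_sub_le (1 / (M : ℂ) ^ w) (1 / (N : ℂ) ^ w)
    rw [e4 M (hN.trans hM), e4 N hN] at h3
    have h4 : (M : ℝ) ^ (-σ) ≤ (N : ℝ) ^ (-σ) :=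
      Real.rpow_le_rpow_of_nonpos hN0 hNM (by linarith)
    have h5 : 2 * (N : ℝ) ^ (-σ) ≤ 2 * (1 + 1 / ‖1 - w‖) * (N : ℝ) ^ (-σ) := by
      have : 0 ≤ 1 / ‖1 - w‖ := by positivity
      have : 0 ≤ (N : ℝ) ^ (-σ) := by positivity
      nlinarith
    rw [e3]
    refine (norm_add₃_le).trans ?_
    linarith
  have ht : Tendsto (fun M : ℕ => B w * (M : ℝ) ^ (-σ) +
      (C + 2) * (1 + 1 / ‖1 - w‖) * (N : ℝ) ^ (-σ)) atTop
      (𝓝 (B w * 0 + (C + 2) * (1 + 1 / ‖1 - w‖) * (N : ℝ) ^ (-σ))) :=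
    (((tendsto_rpow_neg_atTop hσ).comp tendsto_natCast_atTop_atTop).const_mul _).add_const _
  rw [mul_zero, zero_add] at ht
  exact ge_of_tendsto ht ((eventually_ge_atTop N).mono hb)

/-! ### Osgood's lemma in two variables -/

/-- The iterated Cauchy integral `∮∮ G` over the product of two circles, on continuous functions. -/
noncomputable def torusFunctional (a b : ℂ) {R : ℝ} (hR : 0 ≤ R) :
    C(Metric.sphere a R × Metric.sphere b R, ℂ) →L[ℂ] ℂ :=
  have hcd : ∀ c : ℂ, Continuous (deriv (circleMap c R)) := fun c =>
    ((contDiff_circleMap c R).continuous_deriv (n := 1) le_rfl)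
  have hin : ∀ (G : C(Metric.sphere a R × Metric.sphere b R, ℂ)),
      Continuous fun q : ℝ × ℝ => deriv (circleMap b R) q.2 •
        G (⟨circleMap a R q.1, circleMap_mem_sphere a hR q.1⟩,
          ⟨circleMap b R q.2, circleMap_mem_sphere b hR q.2⟩) := fun G =>
    ((hcd b).comp continuous_snd).smul (by fun_prop)
  have hin1 : ∀ (G : C(Metric.sphere a R × Metric.sphere b R, ℂ)) (θ : ℝ),
      Continuous fun φ : ℝ => deriv (circleMap b R) φ •
        G (⟨circleMap a R θ, circleMap_mem_sphere a hR θ⟩,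
          ⟨circleMap b R φ, circleMap_mem_sphere b hR φ⟩) := fun G θ =>
    (hin G).comp (by fun_prop : Continuous fun φ : ℝ => (θ, φ))
  have hout : ∀ (G : C(Metric.sphere a R × Metric.sphere b R, ℂ)),
      Continuous fun θ : ℝ => deriv (circleMap a R) θ • ∫ φ in (0 : ℝ)..2 * Real.pi,
        deriv (circleMap b R) φ • G (⟨circleMap a R θ, circleMap_mem_sphere a hR θ⟩,
          ⟨circleMap b R φ, circleMap_mem_sphere b hR φ⟩) := fun G => by
    refine (hcd a).smul ?_
    exact intervalIntegral.continuous_parametric_intervalIntegral_of_continuous' (hin G) _ _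
  LinearMap.mkContinuous
    { toFun := fun G => ∫ θ in (0 : ℝ)..2 * Real.pi, deriv (circleMap a R) θ •
        ∫ φ in (0 : ℝ)..2 * Real.pi, deriv (circleMap b R) φ •
          G (⟨circleMap a R θ, circleMap_mem_sphere a hR θ⟩,
            ⟨circleMap b R φ, circleMap_mem_sphere b hR φ⟩)
      map_add' := fun G H => by
        rw [← intervalIntegral.integral_add ((hout G).intervalIntegrable _ _)
          ((hout H).intervalIntegrable _ _)]
        refine intervalIntegral.integral_congr fun θ _ => ?_
        simp only [ContinuousMap.add_apply]
        rw [← smul_add, ← intervalIntegral.integral_add ((hin1 G θ).intervalIntegrable _ _)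
          ((hin1 H θ).intervalIntegrable _ _)]
        simp only [smul_add]
      map_smul' := fun c G => by
        rw [RingHom.id_apply, ← intervalIntegral.integral_smul]
        refine intervalIntegral.integral_congr fun θ _ => ?_
        simp only [ContinuousMap.smul_apply]
        rw [smul_comm c, ← intervalIntegral.integral_smul c]
        simp only [smul_eq_mul, mul_left_comm c] }
    (R * (R * |2 * Real.pi - 0|) * |2 * Real.pi - 0|) fun G => by
      have h1 : ∀ θ : ℝ, ‖∫ φ in (0 : ℝ)..2 * Real.pi, deriv (circleMap b R) φ •
          G (⟨circleMap a R θ, circleMap_mem_sphere a hR θ⟩,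
            ⟨circleMap b R φ, circleMap_mem_sphere b hR φ⟩)‖ ≤ R * ‖G‖ * |2 * Real.pi - 0| := by
        intro θ
        refine intervalIntegral.norm_integral_le_of_norm_le_const fun φ _ => ?_
        rw [norm_smul]
        refine mul_le_mul ?_ (G.norm_coe_le_norm _) (norm_nonneg _) hR
        simp [abs_of_nonneg hR]
      refine (intervalIntegral.norm_integral_le_of_norm_le_const
        (C := R * (R * ‖G‖ * |2 * Real.pi - 0|)) fun θ _ => ?_).trans_eq (by ring)
      rw [norm_smul]
      refine mul_le_mul ?_ (h1 θ) (norm_nonneg _) hR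
      simp [abs_of_nonneg hR]

theorem torusFunctional_apply (a b : ℂ) {R : ℝ} (hR : 0 ≤ R)
    (G : C(Metric.sphere a R × Metric.sphere b R, ℂ)) :
    torusFunctional a b hR G = ∫ θ in (0 : ℝ)..2 * Real.pi, deriv (circleMap a R) θ •
        ∫ φ in (0 : ℝ)..2 * Real.pi, deriv (circleMap b R) φ •
          G (⟨circleMap a R θ, circleMap_mem_sphere a hR θ⟩,
            ⟨circleMap b R φ, circleMap_mem_sphere b hR φ⟩) := rfl

/-- Osgood's lemma: a continuous, separately holomorphic function of two variables is analytic. -/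
theorem analyticOnNhd_of_separately {f : ℂ × ℂ → ℂ} {U : Set (ℂ × ℂ)} (hU : IsOpen U)
    (hc : ContinuousOn f U) (h₁ : ∀ p ∈ U, DifferentiableAt ℂ (fun z => f (z, p.2)) p.1)
    (h₂ : ∀ p ∈ U, DifferentiableAt ℂ (fun w => f (p.1, w)) p.2) : AnalyticOnNhd ℂ f U := by
  rintro ⟨a, b⟩ hp
  obtain ⟨R, hR, hRU⟩ := Metric.nhds_basis_closedBall.mem_iff.1 (hU.mem_nhds hp)
  rw [← closedBall_prod_same] at hRU
  have hsub : ∀ {z w : ℂ}, z ∈ Metric.closedBall a R → w ∈ Metric.closedBall b R → (z, w) ∈ U :=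
    fun hz hw => hRU ⟨hz, hw⟩
  let f₀ : C(Metric.sphere a R × Metric.sphere b R, ℂ) := ⟨fun q => f (q.1, q.2), hc.comp_continuous (by fun_prop) fun q =>
    hsub (Metric.sphere_subset_closedBall q.1.2) (Metric.sphere_subset_closedBall q.2.2)⟩
  let c₁ : C(Metric.sphere a R × Metric.sphere b R, ℂ) := ⟨fun q => q.1, by fun_prop⟩
  let c₂ : C(Metric.sphere a R × Metric.sphere b R, ℂ) := ⟨fun q => q.2, by fun_prop⟩
  -- By Cauchy's formula in each variable, f(p) is (2πi)^{-2} times a fixed continuous linear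
  -- functional of f₀ · A(p)⁻¹. Here A is polynomial in p with values in the Banach algebra of
  -- continuous functions on the torus, and inversion is analytic at units, so joint analyticity
  -- follows by composition.
  let A : ℂ × ℂ → C(Metric.sphere a R × Metric.sphere b R, ℂ) := fun p => (c₁ - p.1 • 1) * (c₂ - p.2 • 1)
  have hAapp : ∀ p q, A p q = ((q.1 : ℂ) - p.1) * (q.2 - p.2) := by
    intro p q
    simp [A, c₁, c₂]
  have hAan : AnalyticAt ℂ A (a, b) := by
    refine AnalyticAt.mul (analyticAt_const.sub ?_) (analyticAt_const.sub ?_)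
    · exact analyticAt_fst.smul analyticAt_const
    · exact analyticAt_snd.smul analyticAt_const
  have hne : ∀ {c z y : ℂ}, z ∈ Metric.ball c R → y ∈ Metric.sphere c R → y - z ≠ 0 := by
    intro c z y hz hy h
    rw [sub_eq_zero.1 h] at hy
    exact absurd (Metric.mem_sphere.1 hy) (Metric.mem_ball.1 hz).ne
  have hAu : ∀ p ∈ Metric.ball a R ×ˢ Metric.ball b R, IsUnit (A p) := by
    intro p hp
    rw [ContinuousMap.isUnit_iff_forall_ne_zero]
    intro q
    rw [hAapp]
    exact mul_ne_zero (hne hp.1 q.1.2) (hne hp.2 q.2.2)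
  have hinv : ∀ p ∈ Metric.ball a R ×ˢ Metric.ball b R, ∀ q,
      Ring.inverse (A p) q = ((q.1 : ℂ) - p.1)⁻¹ * ((q.2 : ℂ) - p.2)⁻¹ := by
    intro p hp q
    have h := congrArg (fun g : C(Metric.sphere a R × Metric.sphere b R, ℂ) => g q) (Ring.inverse_mul_cancel _ (hAu p hp))
    simp only [ContinuousMap.mul_apply, ContinuousMap.one_apply, hAapp] at h
    rw [eq_inv_of_mul_eq_one_left h, mul_inv]
  have hmem : ((a, b) : ℂ × ℂ) ∈ Metric.ball a R ×ˢ Metric.ball b R :=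
    ⟨Metric.mem_ball_self hR, Metric.mem_ball_self hR⟩
  have hFan : AnalyticAt ℂ (fun p => torusFunctional a b hR.le (f₀ * Ring.inverse (A p)))
      (a, b) := by
    refine ((torusFunctional a b hR.le).analyticAt _).comp
      (f := fun p => f₀ * Ring.inverse (A p)) (x := ((a, b) : ℂ × ℂ)) ?_
    refine analyticAt_const.mul ?_
    obtain ⟨u, hu⟩ := hAu _ hmem
    have := analyticAt_inverse (𝕜 := ℂ) u
    rw [hu] at this
    exact this.comp (f := A) (x := ((a, b) : ℂ × ℂ)) hAan
  have hdc₁ : ∀ w ∈ Metric.closedBall b R, DiffContOnCl ℂ (fun z => f (z, w)) (Metric.ball a R) := by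
    intro w hw
    refine DifferentiableOn.diffContOnCl fun z hz => ?_
    rw [closure_ball _ hR.ne'] at hz
    exact (h₁ (z, w) (hsub hz hw)).differentiableWithinAt
  have hdc₂ : ∀ z ∈ Metric.closedBall a R, DiffContOnCl ℂ (fun w => f (z, w)) (Metric.ball b R) := by
    intro z hz
    refine DifferentiableOn.diffContOnCl fun w hw => ?_
    rw [closure_ball _ hR.ne'] at hw
    exact (h₂ (z, w) (hsub hz hw)).differentiableWithinAt
  have hF : ∀ p ∈ Metric.ball a R ×ˢ Metric.ball b R,
      torusFunctional a b hR.le (f₀ * Ring.inverse (A p)) =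
        (2 * Real.pi * Complex.I) * ((2 * Real.pi * Complex.I) * f p) := by
    intro p hp
    have e1 := (hdc₁ p.2 (Metric.ball_subset_closedBall hp.2)).circleIntegral_sub_inv_smul hp.1
    have e2 : ∀ z ∈ Metric.sphere a R, _ := fun z hz =>
      (hdc₂ z (Metric.sphere_subset_closedBall hz)).circleIntegral_sub_inv_smul hp.2
    rw [torusFunctional_apply]
    simp only [smul_eq_mul] at e1 e2
    rw [← e1, circleIntegral, ← intervalIntegral.integral_const_mul]
    refine intervalIntegral.integral_congr fun θ _ => ?_
    have e3 := e2 _ (circleMap_mem_sphere a hR.le θ)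
    simp only [smul_eq_mul]
    rw [mul_left_comm, mul_left_comm _ (_⁻¹), ← e3, circleIntegral]
    congr 1
    rw [← intervalIntegral.integral_const_mul]
    refine intervalIntegral.integral_congr fun φ _ => ?_
    simp only [ContinuousMap.mul_apply, hinv p hp, smul_eq_mul, f₀, ContinuousMap.coe_mk]
    ring
  have hfin : (fun p => (2 * Real.pi * Complex.I)⁻¹ * ((2 * Real.pi * Complex.I)⁻¹ *
      torusFunctional a b hR.le (f₀ * Ring.inverse (A p)))) =ᶠ[𝓝 (a, b)] f := by
    filter_upwards [(Metric.isOpen_ball.prod Metric.isOpen_ball).mem_nhds hmem] with p hp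
    rw [hF p hp]
    have : (2 * Real.pi * Complex.I : ℂ) ≠ 0 := Complex.two_pi_I_ne_zero
    field_simp
  exact (analyticAt_const.mul (analyticAt_const.mul hFan)).congr hfin

/-! ### The continuation of the double zeta-function to `Re (s₁ + s₂) > 1` -/

/-- The continuation of the double series to `Re (s₁ + s₂) > 1`. -/
noncomputable def doubleZetaCont (p : ℂ × ℂ) : ℂ :=
  riemannZeta (p.1 + p.2 - 1) / (p.2 - 1) +
    ∑' m : ℕ, ((m + 1 : ℕ) : ℂ) ^ (-p.1) * zetaErr (m + 1) p.2

theorem differentiableAt_zetaErr {m : ℕ} (hm : 1 ≤ m) {s : ℂ} (hs : s ≠ 1) :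
    DifferentiableAt ℂ (zetaErr m) s := by
  have hm0 : (m : ℂ) ≠ 0 := by exact_mod_cast (by omega : m ≠ 0)
  refine ((differentiableAt_riemannZeta hs).sub (differentiable_sum_one_div_cpow m s)).sub ?_
  exact (DifferentiableAt.const_cpow (by fun_prop) (Or.inl hm0)).div (by fun_prop)
    (sub_ne_zero.2 hs)

theorem norm_term_le {m : ℕ} (hm : 1 ≤ m) {s₁ s₂ : ℂ} {B : ℝ}
    (hB : ‖zetaErr m s₂‖ ≤ B * (m : ℝ) ^ (-s₂.re)) :
    ‖(m : ℂ) ^ (-s₁) * zetaErr m s₂‖ ≤ B * (m : ℝ) ^ (-(s₁ + s₂).re) := by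
  have hm0 : (0 : ℝ) < m := by exact_mod_cast hm
  rw [norm_mul, norm_natCast_cpow hm, Complex.neg_re, Complex.add_re, neg_add,
    Real.rpow_add hm0]
  calc (m : ℝ) ^ (-s₁.re) * ‖zetaErr m s₂‖ ≤ (m : ℝ) ^ (-s₁.re) * (B * (m : ℝ) ^ (-s₂.re)) := by
        gcongr
    _ = _ := by ring

/-- A Weierstrass majorant: the m-th term is O(m^{-Re(s₁+s₂)}), with a constant that is locally
bounded because it is continuous in s₂. Near p₀ the exponent stays above some fixed x > 1. -/
theorem exists_nhds_term_bound {p₀ : ℂ × ℂ} (h1 : p₀.2 ≠ 1) (h2 : 1 < (p₀.1 + p₀.2).re) :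
    ∃ V : Set (ℂ × ℂ), IsOpen V ∧ p₀ ∈ V ∧ (∀ p ∈ V, p.2 ≠ 1) ∧ ∃ u : ℕ → ℝ, Summable u ∧
      ∀ m : ℕ, ∀ p ∈ V, ‖((m + 1 : ℕ) : ℂ) ^ (-p.1) * zetaErr (m + 1) p.2‖ ≤ u m := by
  obtain ⟨J, hJ⟩ := exists_nat_gt (-p₀.2.re)
  obtain ⟨B, hBc, hB⟩ := exists_norm_zetaErr_le J
  obtain ⟨x, hx1, hx2⟩ := exists_between h2
  refine ⟨{p : ℂ × ℂ | p.2 ≠ 1} ∩ ({p : ℂ × ℂ | -(J : ℝ) < p.2.re} ∩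
    ({p : ℂ × ℂ | x < (p.1 + p.2).re} ∩ {p : ℂ × ℂ | B p.2 < max (B p₀.2) 0 + 1})), ?_, ?_, fun p hp => hp.1,
    fun m => (max (B p₀.2) 0 + 1) * ((1 : ℕ) + m : ℝ) ^ (-x), ?_, ?_⟩
  · refine (isOpen_ne_fun (by fun_prop) (by fun_prop)).inter ((isOpen_lt (by fun_prop)
      (by fun_prop)).inter ((isOpen_lt (by fun_prop) (by fun_prop)).inter
      (isOpen_lt (by fun_prop) (by fun_prop))))
  · refine ⟨h1, ?_, hx2, ?_⟩
    · simp only [mem_ofPred_eq]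
      linarith
    · simp only [mem_ofPred_eq]
      linarith [le_max_left (B p₀.2) 0]
  · refine Summable.mul_left _ ?_
    have := (summable_nat_add_iff 1).2 (Real.summable_nat_rpow.2 (by linarith : -x < -1))
    refine this.congr fun n => ?_
    push_cast
    rw [add_comm]
  · rintro m p ⟨p1, p2, p3, p4⟩
    refine (norm_term_le (by omega) (hB p.2 p1 p2 (m + 1) (by omega))).trans ?_
    have hb : 0 ≤ max (B p₀.2) 0 + 1 := by positivity
    push_cast
    rw [add_comm (1 : ℝ)]
    refine mul_le_mul (le_of_lt p4) ?_ (by positivity) hb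
    refine Real.rpow_le_rpow_of_exponent_le (by linarith [m.cast_nonneg (α := ℝ)]) ?_
    have : x < (p.1 + p.2).re := p3
    linarith

theorem natCast_succ_ne_zero (m : ℕ) : ((m + 1 : ℕ) : ℂ) ≠ 0 := by
  exact_mod_cast m.succ_ne_zero

/-- The local majorant gives continuity and holomorphy in each variable separately; Osgood's lemma
joins them. -/
theorem analyticOnNhd_tsum_zetaErr :
    AnalyticOnNhd ℂ (fun p : ℂ × ℂ => ∑' m : ℕ, ((m + 1 : ℕ) : ℂ) ^ (-p.1) * zetaErr (m + 1) p.2)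
      {p | p.2 ≠ 1 ∧ 1 < (p.1 + p.2).re} := by
  have hUo : IsOpen {p : ℂ × ℂ | p.2 ≠ 1 ∧ 1 < (p.1 + p.2).re} :=
    (isOpen_ne_fun continuous_snd continuous_const).inter (isOpen_lt continuous_const
      (Complex.continuous_re.comp (continuous_fst.add continuous_snd)))
  have hd1 : ∀ (m : ℕ) (z : ℂ), DifferentiableAt ℂ (fun z => ((m + 1 : ℕ) : ℂ) ^ (-z)) z :=
    fun m z => DifferentiableAt.const_cpow (by fun_prop) (Or.inl (natCast_succ_ne_zero m))
  refine analyticOnNhd_of_separately hUo ?_ ?_ ?_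
  · rintro p ⟨hp1, hp2⟩
    obtain ⟨V, hVo, hpV, hV1, u, hu, hVu⟩ := exists_nhds_term_bound hp1 hp2
    refine ((continuousOn_tsum (fun m => ?_) hu hVu).continuousAt
      (hVo.mem_nhds hpV)).continuousWithinAt
    intro q hq
    refine ContinuousAt.continuousWithinAt (ContinuousAt.mul ?_ ?_)
    · exact (hd1 m q.1).continuousAt.comp continuousAt_fst
    · exact (differentiableAt_zetaErr (by omega) (hV1 q hq)).continuousAt.comp continuousAt_snd
  · rintro p ⟨hp1, hp2⟩
    obtain ⟨V, hVo, hpV, hV1, u, hu, hVu⟩ := exists_nhds_term_bound hp1 hp2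
    have ho : IsOpen ((fun z : ℂ => (z, p.2)) ⁻¹' V) := hVo.preimage (by fun_prop)
    refine (Complex.differentiableOn_tsum_of_summable_norm hu (fun m z hz => ?_) ho
      (fun m z hz => hVu m (z, p.2) hz)).differentiableAt (ho.mem_nhds hpV)
    exact ((hd1 m z).mul_const (zetaErr (m + 1) p.2)).differentiableWithinAt
  · rintro p ⟨hp1, hp2⟩
    obtain ⟨V, hVo, hpV, hV1, u, hu, hVu⟩ := exists_nhds_term_bound hp1 hp2
    have ho : IsOpen ((fun w : ℂ => (p.1, w)) ⁻¹' V) := hVo.preimage (by fun_prop)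
    refine (Complex.differentiableOn_tsum_of_summable_norm hu (fun m w hw => ?_) ho
      (fun m w hw => hVu m (p.1, w) hw)).differentiableAt (ho.mem_nhds hpV)
    exact ((differentiableAt_zetaErr (Nat.le_add_left 1 m)
      (hV1 _ hw)).const_mul (((m + 1 : ℕ) : ℂ) ^ (-p.1))).differentiableWithinAt

theorem tsum_one_div_add_cpow {s : ℂ} (hs : 1 < s.re) (m : ℕ) :
    ∑' n : ℕ, 1 / (((m : ℂ) + 1) + ((n : ℂ) + 1)) ^ s =
      riemannZeta s - ∑ n ∈ Finset.Icc 1 (m + 1), 1 / (n : ℂ) ^ s := by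
  have hsum : Summable fun n : ℕ => 1 / (((m : ℂ) + 1) + ((n : ℂ) + 1)) ^ s := by
    have := (summable_nat_add_iff (m + 2)).2 (Complex.summable_one_div_nat_cpow.2 hs)
    refine this.congr fun n => ?_
    push_cast
    ring_nf
  refine tendsto_nhds_unique hsum.hasSum.tendsto_sum_nat ?_
  refine (tendsto_sum_Ico_cpow hs (m + 1)).congr fun n => ?_
  rw [Finset.sum_Ico_eq_sum_range, add_tsub_cancel_left]
  refine Finset.sum_congr rfl fun k _ => ?_
  rw [Complex.cpow_neg, one_div]
  push_cast
  ring_nf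

/-- The inner sum is the tail of ζ(s₂) beyond m. Its main part m^{1-s₂}/(s₂-1), summed against
m^{-s₁}, gives ζ(s₁+s₂-1)/(s₂-1), convergent since Re(s₁+s₂) > 2. -/
theorem doubleZetaCont_eq_series {p : ℂ × ℂ} (h1 : 1 < p.2.re) (h2 : 2 < (p.1 + p.2).re) :
    doubleZetaCont p = series p.1 p.2 := by
  have hp1 : p.2 ≠ 1 := by
    intro h
    rw [h] at h1
    simp at h1
  obtain ⟨V, -, hpV, -, u, hu, hVu⟩ := exists_nhds_term_bound hp1 (by linarith)
  have hs1 : Summable fun m : ℕ => ((m + 1 : ℕ) : ℂ) ^ (-p.1) * zetaErr (m + 1) p.2 :=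
    Summable.of_norm_bounded hu fun m => hVu m p hpV
  have hw : 1 < (p.1 + p.2 - 1).re := by
    rw [Complex.sub_re, Complex.one_re]
    linarith
  have hs2 : Summable fun m : ℕ => 1 / (m + 1 : ℂ) ^ (p.1 + p.2 - 1) := by
    have := (summable_nat_add_iff 1).2 (Complex.summable_one_div_nat_cpow.2 hw)
    simpa using this
  rw [doubleZetaCont, zeta_eq_tsum_one_div_nat_add_one_cpow hw, ← tsum_div_const,
    ← (hs2.div_const _).tsum_add hs1, series]
  refine tsum_congr fun m => ?_
  rw [tsum_one_div_add_cpow h1, zetaErr]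
  have hm : (m : ℂ) + 1 ≠ 0 := by exact_mod_cast m.succ_ne_zero
  push_cast
  have e1 : 1 / ((m : ℂ) + 1) ^ (p.1 + p.2 - 1) =
      ((m : ℂ) + 1) ^ (-p.1) * ((m : ℂ) + 1) ^ (1 - p.2) := by
    rw [one_div, ← Complex.cpow_neg, ← Complex.cpow_add _ _ hm]
    ring_nf
  rw [e1, one_div, ← Complex.cpow_neg]
  ring

theorem isContinuation_doubleZetaCont : IsContinuation 1 doubleZetaCont := by
  refine ⟨fun p hp => ?_, fun p => doubleZetaCont_eq_series⟩
  obtain ⟨⟨hp1, hp2, -, -⟩, hp3⟩ := hp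
  refine AnalyticAt.add (AnalyticAt.div ?_ (analyticAt_snd.sub analyticAt_const) (sub_ne_zero.2 hp1))
    (analyticOnNhd_tsum_zetaErr p ⟨hp1, hp3⟩)
  have hne : p.1 + p.2 - 1 ≠ 1 := by
    intro h
    apply hp2
    linear_combination h
  have hz : AnalyticAt ℂ riemannZeta (p.1 + p.2 - 1) :=
    differentiableOn_riemannZeta.analyticAt (isOpen_compl_singleton.mem_nhds hne)
  exact hz.comp (f := fun p : ℂ × ℂ => p.1 + p.2 - 1) (x := p)
    ((analyticAt_fst.add analyticAt_snd).sub analyticAt_const)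

theorem zeta₂_eq_doubleZetaCont {s₁ s₂ : ℂ} (h : (s₁, s₂) ∈ regularSet) (h1 : 1 < (s₁ + s₂).re) :
    zeta₂ s₁ s₂ = doubleZetaCont (s₁, s₂) :=
  zeta₂_eq isContinuation_doubleZetaCont ⟨h, h1⟩

/-! ### Mean squares of functions approximated by Dirichlet polynomials -/

/-- The Dirichlet polynomial `∑_{m ≤ N} x_m m^{-it}`. -/
noncomputable def dirichletPoly (x : ℕ → ℂ) (N : ℕ) (t : ℝ) : ℂ :=
  ∑ m ∈ Finset.Icc 1 N, x m * Complex.exp (-(t * Real.log m * Complex.I))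

/-- `F` is continuous on `[2, ∞)`, and approximated at `t` by the Dirichlet polynomials of length
`N ≥ κ t` with coefficients `x_m ≪ m^{-σ}`, with an error `≪ N^{1-σ} / t`. -/
structure IsApprox (F : ℝ → ℂ) (x : ℕ → ℂ) (σ C κ : ℝ) : Prop where
  continuousOn : ContinuousOn F (Ici 2)
  one_le : 1 ≤ κ
  nonneg : 0 ≤ C
  coeff_le : ∀ m : ℕ, 1 ≤ m → ‖x m‖ ≤ C * (m : ℝ) ^ (-σ)
  approx : ∀ (t : ℝ) (N : ℕ), 2 ≤ t → κ * t ≤ N →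
    ‖F t - dirichletPoly x N t‖ ≤ C * ((N : ℝ) ^ (1 - σ) / t)

theorem continuous_dirichletPoly (x : ℕ → ℂ) (N : ℕ) : Continuous (dirichletPoly x N) := by
  unfold dirichletPoly
  fun_prop

theorem norm_dirichletPoly_le (x : ℕ → ℂ) (N : ℕ) (t : ℝ) :
    ‖dirichletPoly x N t‖ ≤ ∑ m ∈ Finset.Icc 1 N, ‖x m‖ := by
  refine (norm_sum_le _ _).trans_eq (Finset.sum_congr rfl fun m _ => ?_)
  rw [norm_mul, show -((t : ℂ) * Real.log m * Complex.I) =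
    ((-(t * Real.log m) : ℝ) : ℂ) * Complex.I by push_cast; ring, Complex.norm_exp_ofReal_mul_I,
    mul_one]

theorem abs_sq_norm_sub_le {a b : ℂ} {ρ : ℝ} (h : ‖a - b‖ ≤ ρ) :
    |‖a‖ ^ 2 - ‖b‖ ^ 2| ≤ 2 * ‖b‖ * ρ + ρ ^ 2 := by
  have h1 := (abs_norm_sub_norm_le a b).trans h
  have h2 : |‖a‖ + ‖b‖| ≤ 2 * ‖b‖ + ρ := by
    rw [abs_of_nonneg (by positivity)]
    linarith [(abs_le.1 h1).2]
  rw [sq_sub_sq, abs_mul]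
  calc |‖a‖ + ‖b‖| * |‖a‖ - ‖b‖| ≤ (2 * ‖b‖ + ρ) * ρ :=
        mul_le_mul h2 h1 (abs_nonneg _) ((abs_nonneg _).trans h2)
    _ = _ := by ring

/-- The partial sums of the mean square of the coefficients. -/
noncomputable def sqSum (x : ℕ → ℂ) (N : ℕ) : ℝ := ∑ m ∈ Finset.Icc 1 N, ‖x m‖ ^ 2

theorem sqSum_nonneg (x : ℕ → ℂ) (N : ℕ) : 0 ≤ sqSum x N :=
  Finset.sum_nonneg fun _ _ => by positivity

namespace IsApprox

variable {F : ℝ → ℂ} {x : ℕ → ℂ} {σ C κ : ℝ}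

theorem intervalIntegrable (h : IsApprox F x σ C κ) {A B : ℝ} (hA : 2 ≤ A) (hAB : A ≤ B) :
    IntervalIntegrable (fun t => ‖F t‖ ^ 2) volume A B := by
  refine ContinuousOn.intervalIntegrable ?_
  rw [uIcc_of_le hAB]
  exact (h.continuousOn.mono fun t ht => hA.trans ht.1).norm.pow 2

theorem sum_norm_le (h : IsApprox F x σ C κ) (N : ℕ) :
    ∑ m ∈ Finset.Icc 1 N, ‖x m‖ ≤ C * ∑ m ∈ Finset.Icc 1 N, (m : ℝ) ^ (-σ) := by
  rw [Finset.mul_sum]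
  exact Finset.sum_le_sum fun m hm => h.coeff_le m (Finset.mem_Icc.1 hm).1

theorem sq_coeff_le (h : IsApprox F x σ C κ) {m : ℕ} (hm : 1 ≤ m) :
    ‖x m‖ ^ 2 ≤ C ^ 2 * (m : ℝ) ^ (-(2 * σ)) := by
  have := pow_le_pow_left₀ (norm_nonneg _) (h.coeff_le m hm) 2
  rw [mul_pow, ← Real.rpow_mul_natCast (Nat.cast_nonneg m)] at this
  refine this.trans_eq ?_
  congr 2
  push_cast
  ring

theorem sum_mul_sq_le (h : IsApprox F x σ C κ) (N : ℕ) :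
    ∑ m ∈ Finset.Icc 1 N, m * ‖x m‖ ^ 2 ≤
      C ^ 2 * ∑ m ∈ Finset.Icc 1 N, (m : ℝ) ^ (-(2 * σ - 1)) := by
  rw [Finset.mul_sum]
  refine Finset.sum_le_sum fun m hm => ?_
  have hm1 := (Finset.mem_Icc.1 hm).1
  have hm0 : (0 : ℝ) < m := by exact_mod_cast hm1
  calc m * ‖x m‖ ^ 2 ≤ m * (C ^ 2 * (m : ℝ) ^ (-(2 * σ))) := by
        gcongr
        exact h.sq_coeff_le hm1
    _ = _ := by
        rw [show -(2 * σ - 1) = -(2 * σ) + 1 by ring, Real.rpow_add_one hm0.ne']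
        ring

theorem abs_integral_sub_le (h : IsApprox F x σ C κ) {A B : ℝ} (hA : 2 ≤ A) (hAB : A ≤ B) {N : ℕ}
    {g : ℝ → ℝ} (hg : IntervalIntegrable g volume A B)
    (hb : ∀ t ∈ Icc A B, |‖F t‖ ^ 2 - ‖dirichletPoly x N t‖ ^ 2| ≤ g t) :
    |(∫ t in A..B, ‖F t‖ ^ 2) - (B - A) * sqSum x N| ≤ (∫ t in A..B, g t) +
      2 * (Real.pi * ∑ m ∈ Finset.Icc 1 N, m * ‖x m‖ ^ 2 +
        2 * (∑ m ∈ Finset.Icc 1 N, ‖x m‖) ^ 2) := by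
  have hS : IntervalIntegrable (fun t => ‖dirichletPoly x N t‖ ^ 2) volume A B :=
    ((continuous_dirichletPoly x N).norm.pow 2).intervalIntegrable _ _
  have h1 : |(∫ t in A..B, ‖F t‖ ^ 2) - ∫ t in A..B, ‖dirichletPoly x N t‖ ^ 2| ≤
      ∫ t in A..B, g t := by
    rw [← intervalIntegral.integral_sub (h.intervalIntegrable hA hAB) hS, ← Real.norm_eq_abs]
    refine intervalIntegral.norm_integral_le_of_norm_le hAB (ae_of_all _ fun t ht => ?_) hg
    exact hb t ⟨ht.1.le, ht.2⟩
  have h2 := abs_integral_dirichletPoly_sub_le N x A B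
  exact (abs_sub_le _ _ _).trans (add_le_add h1 h2)

theorem summable_sq (h : IsApprox F x σ C κ) (hσ : 1 / 2 < σ) :
    Summable fun m : ℕ => ‖x (m + 1)‖ ^ 2 := by
  refine Summable.of_nonneg_of_le (fun m => by positivity)
    (fun m => h.sq_coeff_le (Nat.le_add_left 1 m)) (Summable.mul_left _ ?_)
  exact (summable_nat_add_iff 1).2 (Real.summable_nat_rpow.2 (by linarith : -(2 * σ) < -1))

theorem abs_tsum_sub_sqSum_le (h : IsApprox F x σ C κ) (hσ : 1 / 2 < σ) {N : ℕ} (hN : 1 ≤ N) :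
    |(∑' m : ℕ, ‖x (m + 1)‖ ^ 2) - sqSum x N| ≤
      C ^ 2 / (2 * σ - 1) * (N : ℝ) ^ (-(2 * σ - 1)) := by
  have hα : 0 < 2 * σ - 1 := by linarith
  have e : sqSum x N = ∑ m ∈ Finset.range N, ‖x (m + 1)‖ ^ 2 := by
    rw [sqSum, ← Finset.Ico_succ_right_eq_Icc, Finset.sum_Ico_eq_sum_range]
    exact Finset.sum_congr (by simp) fun k _ => by rw [add_comm]
  rw [e, ← (h.summable_sq hσ).sum_add_tsum_nat_add N, add_sub_cancel_left,
    abs_of_nonneg (tsum_nonneg fun m => by positivity)]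
  have hs := summable_rpow_shift hα hN
  calc ∑' i : ℕ, ‖x (i + N + 1)‖ ^ 2
      ≤ ∑' i : ℕ, C ^ 2 * ((N : ℝ) + i + 1) ^ (-(2 * σ - 1 + 1)) := by
        refine Summable.tsum_le_tsum (fun i => ?_)
          ((summable_nat_add_iff N).2 (h.summable_sq hσ)) (hs.mul_left _)
        refine (h.sq_coeff_le (by omega)).trans_eq ?_
        push_cast
        ring_nf
    _ ≤ C ^ 2 * ((N : ℝ) ^ (-(2 * σ - 1)) / (2 * σ - 1)) := by
        rw [tsum_mul_left]
        exact mul_le_mul_of_nonneg_left (tsum_rpow_shift_le hα hN) (by positivity)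
    _ = _ := by ring

/-- The coefficient sums are bounded uniformly in N, so for fixed T one may let N → ∞: the
approximation error disappears and only the bounded off-diagonal term remains. -/
theorem mean_square_of_one_lt (h : IsApprox F x σ C κ) (hσ : 1 < σ) :
    ∃ K : ℝ, ∀ T : ℝ, 2 ≤ T →
      |(∫ t in (2 : ℝ)..T, ‖F t‖ ^ 2) - (∑' m : ℕ, ‖x (m + 1)‖ ^ 2) * T| ≤ K := by
  set V := ∑' m : ℕ, ‖x (m + 1)‖ ^ 2 with hV
  set M := C * (1 + 1 / (σ - 1)) with hM
  set M₂ := C ^ 2 * (1 + 1 / (2 * σ - 1 - 1)) with hM₂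
  have hS : ∀ N, ∑ m ∈ Finset.Icc 1 N, ‖x m‖ ≤ M := fun N => (h.sum_norm_le N).trans
    (mul_le_mul_of_nonneg_left (sum_Icc_rpow_le_of_one_lt hσ N) h.nonneg)
  have hS₂ : ∀ N, ∑ m ∈ Finset.Icc 1 N, m * ‖x m‖ ^ 2 ≤ M₂ := fun N => (h.sum_mul_sq_le N).trans
    (mul_le_mul_of_nonneg_left (sum_Icc_rpow_le_of_one_lt (by linarith) N) (by positivity))
  have hM0 : 0 ≤ M := (Finset.sum_nonneg fun _ _ => norm_nonneg _).trans (hS 0)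
  set K := 2 * (Real.pi * M₂ + 2 * M ^ 2) with hK
  refine ⟨K + 2 * |V|, fun T hT => ?_⟩
  have key : ∀ N : ℕ, κ * T ≤ N → |(∫ t in (2 : ℝ)..T, ‖F t‖ ^ 2) - (T - 2) * sqSum x N| ≤
      (T - 2) * (2 * M * (C * (N : ℝ) ^ (-(σ - 1))) + (C * (N : ℝ) ^ (-(σ - 1))) ^ 2) + K := by
    intro N hN
    have hb := h.abs_integral_sub_le le_rfl hT (N := N) (g := fun _ =>
      2 * M * (C * (N : ℝ) ^ (-(σ - 1))) + (C * (N : ℝ) ^ (-(σ - 1))) ^ 2)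
      intervalIntegrable_const ?_
    · refine hb.trans (add_le_add ?_ ?_)
      · rw [intervalIntegral.integral_const, smul_eq_mul]
      · have h1 := hS N
        have h2 := hS₂ N
        have h3 : 0 ≤ ∑ m ∈ Finset.Icc 1 N, ‖x m‖ := Finset.sum_nonneg fun _ _ => norm_nonneg _
        have hpi := Real.pi_pos
        rw [hK]
        gcongr
    · intro t ht
      have ht2 : 2 ≤ t := ht.1
      have hκ := h.one_le
      have h1 := h.approx t N ht.1 (le_trans (by gcongr; exact ht.2) hN)
      have h2 : C * ((N : ℝ) ^ (1 - σ) / t) ≤ C * (N : ℝ) ^ (-(σ - 1)) := by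
        rw [neg_sub]
        exact mul_le_mul_of_nonneg_left (div_le_self (by positivity) (by linarith)) h.nonneg
      refine (abs_sq_norm_sub_le (h1.trans h2)).trans ?_
      have h3 := (norm_dirichletPoly_le x N t).trans (hS N)
      have h4 := h.nonneg
      gcongr
  have ht1 : Tendsto (fun N : ℕ => C * (N : ℝ) ^ (-(σ - 1))) atTop (𝓝 0) := by
    have := ((tendsto_rpow_neg_atTop (by linarith : 0 < σ - 1)).comp
      tendsto_natCast_atTop_atTop).const_mul C
    rwa [mul_zero] at this
  have ht2 : Tendsto (fun N : ℕ => (T - 2) * (2 * M * (C * (N : ℝ) ^ (-(σ - 1))) +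
      (C * (N : ℝ) ^ (-(σ - 1))) ^ 2) + K) atTop (𝓝 K) := by
    have := (((ht1.const_mul (2 * M)).add (ht1.pow 2)).const_mul (T - 2)).add_const K
    simpa using this
  have ht3 : Tendsto (sqSum x) atTop (𝓝 V) := by
    rw [tendsto_iff_norm_sub_tendsto_zero]
    have := ((tendsto_rpow_neg_atTop (by linarith : 0 < 2 * σ - 1)).comp
      tendsto_natCast_atTop_atTop).const_mul (C ^ 2 / (2 * σ - 1))
    rw [mul_zero] at this
    refine squeeze_zero' (Eventually.of_forall fun _ => norm_nonneg _) ?_ this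
    filter_upwards [eventually_ge_atTop 1] with N hN
    rw [norm_sub_rev]
    exact h.abs_tsum_sub_sqSum_le (by linarith) hN
  have ht4 : Tendsto (fun N : ℕ => |(∫ t in (2 : ℝ)..T, ‖F t‖ ^ 2) - (T - 2) * sqSum x N|) atTop
      (𝓝 |(∫ t in (2 : ℝ)..T, ‖F t‖ ^ 2) - (T - 2) * V|) :=
    ((ht3.const_mul (T - 2)).const_sub _).abs
  have hfin : |(∫ t in (2 : ℝ)..T, ‖F t‖ ^ 2) - (T - 2) * V| ≤ K := by
    refine le_of_tendsto_of_tendsto ht4 ht2 ?_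
    filter_upwards [tendsto_natCast_atTop_atTop.eventually_ge_atTop (κ * T)] with N hN
    exact key N hN
  have e : (∫ t in (2 : ℝ)..T, ‖F t‖ ^ 2) - V * T =
      ((∫ t in (2 : ℝ)..T, ‖F t‖ ^ 2) - (T - 2) * V) - 2 * V := by ring
  rw [e]
  refine (abs_sub _ _).trans (add_le_add hfin ?_)
  rw [abs_mul, abs_two]

theorem exists_length (h : IsApprox F x σ C κ) {T : ℝ} (hT : 2 ≤ T) :
    ∃ N : ℕ, 1 ≤ N ∧ κ * T ≤ N ∧ T ≤ N ∧ (N : ℝ) ≤ (κ + 1) * T := by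
  have hκ := h.one_le
  have h1 : κ * T ≤ ⌈κ * T⌉₊ := Nat.le_ceil _
  have h2 : T ≤ ⌈κ * T⌉₊ := by nlinarith
  refine ⟨⌈κ * T⌉₊, ?_, h1, h2, ?_⟩
  · have : (1 : ℝ) ≤ ⌈κ * T⌉₊ := by linarith
    exact_mod_cast this
  · have := (Nat.ceil_lt_add_one (by positivity : 0 ≤ κ * T)).le
    linarith

/-- With N ≍ T the error of approximation is O(1/t) and ∑ |x_m| = O(log T). The cross term log T · ∫
dt/t and the off-diagonal term (∑ |x_m|)² both have size (log T)²; the tail of ∑ |x_m|² contributes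
O(T/N) = O(1). -/
theorem mean_square_of_eq_one (h : IsApprox F x 1 C κ) :
    ∃ K : ℝ, ∀ T : ℝ, 2 ≤ T →
      |(∫ t in (2 : ℝ)..T, ‖F t‖ ^ 2) - (∑' m : ℕ, ‖x (m + 1)‖ ^ 2) * T| ≤
        K * Real.log T ^ 2 := by
  set V := ∑' m : ℕ, ‖x (m + 1)‖ ^ 2 with hV
  have hC := h.nonneg
  have hκ := h.one_le
  set D := 2 * (1 + Real.log (κ + 1)) + 1 with hD
  have hlκ : 0 ≤ Real.log (κ + 1) := Real.log_nonneg (by linarith)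
  have hpi := Real.pi_pos
  refine ⟨2 * (C * D) * C + 2 * C ^ 2 + 2 * (Real.pi * (2 * (C ^ 2 * D)) + 2 * (C * D) ^ 2) +
    8 * C ^ 2 + 8 * |V|, fun T hT => ?_⟩
  have hT0 : 0 < T := by linarith
  obtain ⟨N, hN1, hN2, hN3, hN4⟩ := h.exists_length hT
  have hN0 : (0 : ℝ) < N := by linarith
  have hlT : 1 / 2 ≤ Real.log T := by
    have := Real.log_le_log two_pos hT
    linarith [Real.log_two_gt_d9]
  have hlN : 1 + Real.log N ≤ D * Real.log T := by
    have := Real.log_le_log hN0 hN4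
    rw [Real.log_mul (by linarith) hT0.ne'] at this
    rw [hD]
    nlinarith
  have hS : ∑ m ∈ Finset.Icc 1 N, ‖x m‖ ≤ C * D * Real.log T := by
    rw [mul_assoc]
    exact (h.sum_norm_le N).trans
      (mul_le_mul_of_nonneg_left ((sum_Icc_rpow_neg_one_le N).trans hlN) hC)
  have hS₂ : ∑ m ∈ Finset.Icc 1 N, m * ‖x m‖ ^ 2 ≤ C ^ 2 * D * Real.log T := by
    rw [mul_assoc]
    refine (h.sum_mul_sq_le N).trans (mul_le_mul_of_nonneg_left ?_ (by positivity))
    norm_num1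
    exact (sum_Icc_rpow_neg_one_le N).trans hlN
  have hinv : IntervalIntegrable (fun t : ℝ => t⁻¹) volume 2 T := by
    refine intervalIntegral.intervalIntegrable_inv (fun t ht => ?_) continuousOn_id
    rw [uIcc_of_le hT] at ht
    exact (by linarith [ht.1] : (0 : ℝ) < t).ne'
  have hb := h.abs_integral_sub_le le_rfl hT (N := N)
    (g := fun t => (2 * (C * D * Real.log T) * C + C ^ 2) * t⁻¹) (hinv.const_mul _) (by
      intro t ht
      have ht2 : 2 ≤ t := ht.1
      have ht0 : 0 < t := by linarith
      have h1 := h.approx t N ht.1 (le_trans (by gcongr; exact ht.2) hN2)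
      rw [sub_self, Real.rpow_zero, one_div] at h1
      refine (abs_sq_norm_sub_le h1).trans ?_
      have h3 := (norm_dirichletPoly_le x N t).trans hS
      have h5 : t⁻¹ ≤ 1 := inv_le_one_of_one_le₀ (by linarith)
      have h6 : 0 ≤ t⁻¹ := by positivity
      have h7 : (C * t⁻¹) ^ 2 ≤ C ^ 2 * t⁻¹ := by
        rw [mul_pow, sq t⁻¹]
        nlinarith [mul_nonneg (sq_nonneg C) h6]
      have h8 : 2 * ‖dirichletPoly x N t‖ * (C * t⁻¹) ≤ 2 * (C * D * Real.log T) * (C * t⁻¹) := by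
        gcongr
      linarith)
  have hint : ∫ t in (2 : ℝ)..T, (2 * (C * D * Real.log T) * C + C ^ 2) * t⁻¹ ≤
      (2 * (C * D) * C + 2 * C ^ 2) * Real.log T ^ 2 := by
    rw [intervalIntegral.integral_const_mul, integral_inv_of_pos two_pos hT0,
      Real.log_div hT0.ne' two_ne_zero]
    have h2 : 0 ≤ Real.log 2 := Real.log_nonneg (by norm_num)
    calc (2 * (C * D * Real.log T) * C + C ^ 2) * (Real.log T - Real.log 2)
        ≤ (2 * (C * D * Real.log T) * C + C ^ 2 * (2 * Real.log T)) * Real.log T := by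
          have : C ^ 2 * 1 ≤ C ^ 2 * (2 * Real.log T) := by gcongr; linarith
          have h0 : 0 ≤ 2 * (C * D * Real.log T) * C + C ^ 2 := by positivity
          have := mul_le_mul_of_nonneg_left (sub_le_self (Real.log T) h2) h0
          refine this.trans ?_
          gcongr
          linarith
      _ = _ := by ring
  have hdiag : |(V - sqSum x N) * T| ≤ C ^ 2 := by
    have h1 := h.abs_tsum_sub_sqSum_le (by norm_num) hN1
    norm_num1 at h1
    rw [Real.rpow_neg_one] at h1
    rw [abs_mul, abs_of_pos hT0]
    calc |V - sqSum x N| * T ≤ C ^ 2 / 1 * (N : ℝ)⁻¹ * T := by gcongr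
      _ = C ^ 2 * (T / N) := by ring
      _ ≤ C ^ 2 * 1 := by
          gcongr
          exact (div_le_one hN0).2 hN3
      _ = C ^ 2 := mul_one _
  have hl2 : 1 ≤ 4 * Real.log T ^ 2 := by nlinarith
  have hoff : 2 * (Real.pi * ∑ m ∈ Finset.Icc 1 N, m * ‖x m‖ ^ 2 +
      2 * (∑ m ∈ Finset.Icc 1 N, ‖x m‖) ^ 2) ≤
      2 * (Real.pi * (2 * (C ^ 2 * D)) + 2 * (C * D) ^ 2) * Real.log T ^ 2 := by
    have h3 : 0 ≤ ∑ m ∈ Finset.Icc 1 N, ‖x m‖ := Finset.sum_nonneg fun _ _ => norm_nonneg _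
    have h4 : ∑ m ∈ Finset.Icc 1 N, m * ‖x m‖ ^ 2 ≤ 2 * (C ^ 2 * D) * Real.log T ^ 2 := by
      refine hS₂.trans ?_
      have : 0 ≤ C ^ 2 * D := by positivity
      nlinarith [mul_nonneg this (by linarith : 0 ≤ Real.log T)]
    calc _ ≤ 2 * (Real.pi * (2 * (C ^ 2 * D) * Real.log T ^ 2) +
          2 * (C * D * Real.log T) ^ 2) := by gcongr
      _ = _ := by ring
  have e : (∫ t in (2 : ℝ)..T, ‖F t‖ ^ 2) - V * T =
      ((∫ t in (2 : ℝ)..T, ‖F t‖ ^ 2) - (T - 2) * sqSum x N) - (V - sqSum x N) * T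
        + 2 * (V - sqSum x N) - 2 * V := by ring
  have hV2 : |2 * (V - sqSum x N) - 2 * V| ≤ C ^ 2 + 2 * |V| * 1 := by
    refine (abs_sub _ _).trans (add_le_add ?_ ?_)
    · rw [abs_mul] at hdiag
      rw [abs_mul, abs_two, mul_comm]
      refine le_trans (mul_le_mul_of_nonneg_left ?_ (abs_nonneg _)) hdiag
      rwa [abs_of_pos hT0]
    · rw [abs_mul, abs_two, mul_one]
  rw [e, add_sub_assoc]
  refine (abs_add_le _ _).trans ((add_le_add (abs_sub _ _) hV2).trans ?_)
  have hf1 : C ^ 2 * 1 ≤ C ^ 2 * (4 * Real.log T ^ 2) := by gcongr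
  have hf2 : |V| * 1 ≤ |V| * (4 * Real.log T ^ 2) := by gcongr
  linarith

end IsApprox

/-- Halving T until it lies in [2, 4] sums a geometric series of ratio 2^{-β}. The constant K' in
the induction is the fixed point of K' = 2^{-β} K' + K. -/
theorem exists_le_of_dyadic {f : ℝ → ℝ} {β K : ℝ} (hβ : 0 < β) (hK : 0 ≤ K)
    (h₀ : ∀ T ∈ Icc (2 : ℝ) 4, |f T| ≤ K)
    (h : ∀ T, 4 ≤ T → |f T - f (T / 2)| ≤ K * T ^ β) :
    ∃ C : ℝ, ∀ T, 2 ≤ T → |f T| ≤ C * T ^ β := by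
  have hq : (2 : ℝ) ^ (-β) < 1 := Real.rpow_lt_one_of_one_lt_of_neg one_lt_two (by linarith)
  have hq' : 0 < 1 - (2 : ℝ) ^ (-β) := by linarith
  set K' := K / (1 - (2 : ℝ) ^ (-β)) with hK'
  have hK'0 : 0 ≤ K' := by positivity
  have hK'e : K' * (2 : ℝ) ^ (-β) + K = K' := by
    rw [hK']
    field_simp
    ring
  have key : ∀ (n : ℕ) (T : ℝ), 2 ≤ T → T ≤ 4 * 2 ^ n → |f T| ≤ K + K' * T ^ β := by
    intro n
    induction n with
    | zero =>
      intro T h1 h2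
      have := h₀ T ⟨h1, by simpa using h2⟩
      have : 0 ≤ K' * T ^ β := by positivity
      linarith
    | succ n ih =>
      intro T h1 h2
      rcases le_total T 4 with h4 | h4
      · have := h₀ T ⟨h1, h4⟩
        have : 0 ≤ K' * T ^ β := by positivity
        linarith
      · have i1 := ih (T / 2) (by linarith) (by rw [pow_succ] at h2; linarith)
        have i2 := h T h4
        have i3 : (T / 2) ^ β = (2 : ℝ) ^ (-β) * T ^ β := by
          rw [Real.div_rpow (by linarith) two_pos.le, Real.rpow_neg two_pos.le]
          ring
        rw [i3] at i1
        have i4 : |f T| ≤ |f T - f (T / 2)| + |f (T / 2)| := by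
          simpa using abs_add_le (f T - f (T / 2)) (f (T / 2))
        have i5 : K' * T ^ β = K' * ((2 : ℝ) ^ (-β) * T ^ β) + K * T ^ β := by
          rw [← mul_assoc, ← add_mul, hK'e]
        linarith
  refine ⟨K + K', fun T hT => ?_⟩
  obtain ⟨n, hn⟩ := pow_unbounded_of_one_lt T one_lt_two
  have h1 := key n T hT (by linarith [hn])
  have h2 : 1 ≤ T ^ β := Real.one_le_rpow (by linarith) hβ.le
  nlinarith

namespace IsApprox

variable {F : ℝ → ℂ} {x : ℕ → ℂ} {σ C κ : ℝ}

/-- On [T/2, T] the polynomial of length N ≍ T approximates with error O(T^{-σ}). The parameter l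
weights the cross term between polynomial and error; it is left free since its good choice differs
for σ > 1/2 and σ = 1/2. -/
theorem dyadic_mean_square (h : IsApprox F x σ C κ) (hσ : 1 / 2 ≤ σ) (hσ1 : σ < 1) :
    ∃ K : ℝ, 0 ≤ K ∧ ∀ T : ℝ, 4 ≤ T → ∃ N : ℕ, 1 ≤ N ∧ T ≤ N ∧ (N : ℝ) ≤ (κ + 1) * T ∧
      ∀ l : ℝ, 0 < l → l ≤ 1 →
        |(∫ t in (T / 2)..T, ‖F t‖ ^ 2) - T / 2 * sqSum x N| ≤
          K * (T ^ (2 - 2 * σ) + l * (T * sqSum x N) + T ^ (1 - 2 * σ) / l) := by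
  have hC := h.nonneg
  have hκ := h.one_le
  have hpi := Real.pi_pos
  set k := (κ + 1) ^ (1 - σ) with hk
  have hk0 : 0 < k := by positivity
  set C₁ := 2 * (Real.pi * (C ^ 2 * (k ^ 2 / (2 - 2 * σ))) +
    2 * (C * (k / (1 - σ))) ^ 2) with hC₁
  have hs1 : 0 < 1 - σ := by linarith
  have hs2 : 0 < 2 - 2 * σ := by linarith
  have hC₁0 : 0 ≤ C₁ := by positivity
  set c := 2 * C * k with hc
  refine ⟨1 + 2 * C₁ + 2 * c ^ 2, by positivity, fun T hT => ?_⟩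
  have hT0 : 0 < T := by linarith
  obtain ⟨N, hN1, hN2, hN3, hN4⟩ := h.exists_length (by linarith : 2 ≤ T)
  refine ⟨N, hN1, hN3, hN4, fun l hl0 hl1 => ?_⟩
  have hN0 : (0 : ℝ) < N := by linarith
  have hNs : (N : ℝ) ^ (1 - σ) ≤ k * T ^ (1 - σ) := by
    rw [hk, ← Real.mul_rpow (by linarith) hT0.le]
    exact Real.rpow_le_rpow hN0.le hN4 hs1.le
  have hsq : ∀ y : ℝ, 0 < y → y ^ (2 - 2 * σ) = (y ^ (1 - σ)) ^ 2 := by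
    intro y hy
    rw [← Real.rpow_mul_natCast hy.le]
    congr 1
    push_cast
    ring
  have hoff : 2 * (Real.pi * ∑ m ∈ Finset.Icc 1 N, m * ‖x m‖ ^ 2 +
      2 * (∑ m ∈ Finset.Icc 1 N, ‖x m‖) ^ 2) ≤ C₁ * T ^ (2 - 2 * σ) := by
    have h1 : ∑ m ∈ Finset.Icc 1 N, ‖x m‖ ≤ C * (k * T ^ (1 - σ) / (1 - σ)) := by
      refine (h.sum_norm_le N).trans (mul_le_mul_of_nonneg_left ?_ hC)
      refine (sum_Icc_rpow_le_of_lt_one (by linarith) hσ1 N).trans ?_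
      gcongr
    have h2 : ∑ m ∈ Finset.Icc 1 N, m * ‖x m‖ ^ 2 ≤
        C ^ 2 * ((k * T ^ (1 - σ)) ^ 2 / (2 - 2 * σ)) := by
      refine (h.sum_mul_sq_le N).trans (mul_le_mul_of_nonneg_left ?_ (by positivity))
      refine (sum_Icc_rpow_le_of_lt_one (by linarith) (by linarith) N).trans ?_
      rw [show 1 - (2 * σ - 1) = 2 - 2 * σ by ring, hsq _ hN0]
      gcongr
    have h3 : 0 ≤ ∑ m ∈ Finset.Icc 1 N, ‖x m‖ := Finset.sum_nonneg fun _ _ => norm_nonneg _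
    calc _ ≤ 2 * (Real.pi * (C ^ 2 * ((k * T ^ (1 - σ)) ^ 2 / (2 - 2 * σ))) +
          2 * (C * (k * T ^ (1 - σ) / (1 - σ))) ^ 2) := by gcongr
      _ = _ := by
        rw [hC₁, hsq _ hT0]
        ring
  have hS := abs_le.1 (abs_integral_dirichletPoly_sub_le N x (T / 2) T)
  have hSub := hS.2.trans hoff
  set S₂ := ∫ t in (T / 2)..T, ‖dirichletPoly x N t‖ ^ 2 with hS₂
  -- The mean value theorem is used a second time, as an upper bound for the polynomial in the cross
  -- term.
  have hS₂le : S₂ ≤ T * sqSum x N + C₁ * T ^ (2 - 2 * σ) := by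
    have h1 : 0 ≤ T * sqSum x N := mul_nonneg hT0.le (sqSum_nonneg x N)
    have h2 : S₂ - (T - T / 2) * sqSum x N ≤ C₁ * T ^ (2 - 2 * σ) := hSub
    linarith
  set ρ := c * T ^ (-σ) with hρ
  have hρ2 : T * ρ ^ 2 = c ^ 2 * T ^ (1 - 2 * σ) := by
    have : T ^ (1 - 2 * σ) = T * (T ^ (-σ)) ^ 2 := by
      rw [← Real.rpow_mul_natCast hT0.le, show 1 - 2 * σ = -σ * (2 : ℕ) + 1 by push_cast; ring,
        Real.rpow_add_one hT0.ne']
      ring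
    rw [this, hρ]
    ring
  -- The majorant comes from 2bρ ≤ l b² + ρ²/l, together with ρ² ≤ ρ²/l because l ≤ 1.
  have hb := h.abs_integral_sub_le (A := T / 2) (B := T) (by linarith) (by linarith) (N := N)
    (g := fun t => l * ‖dirichletPoly x N t‖ ^ 2 + 2 * ρ ^ 2 / l)
    (Continuous.intervalIntegrable (by have := continuous_dirichletPoly x N; fun_prop) _ _) (by
      intro t ht
      have ht2 : 2 ≤ t := by linarith [ht.1]
      have ht0 : 0 < t := by linarith
      have h1 := h.approx t N ht2 (le_trans (by gcongr; exact ht.2) hN2)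
      have h2 : C * ((N : ℝ) ^ (1 - σ) / t) ≤ ρ := by
        calc C * ((N : ℝ) ^ (1 - σ) / t) ≤ C * (k * T ^ (1 - σ) / (T / 2)) := by
              gcongr
              exact ht.1
          _ = ρ := by
              rw [hρ, hc, show -σ = (1 - σ) - 1 by ring, Real.rpow_sub_one hT0.ne']
              field_simp
      refine (abs_sq_norm_sub_le (h1.trans h2)).trans ?_
      set b := ‖dirichletPoly x N t‖
      have h3 : ρ ^ 2 ≤ ρ ^ 2 / l := le_div_self (sq_nonneg _) hl0 hl1
      have h4 : 2 * b * ρ ≤ l * b ^ 2 + ρ ^ 2 / l := by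
        have : 0 ≤ (l * b - ρ) ^ 2 / l := by positivity
        have e : (l * b - ρ) ^ 2 / l = l * b ^ 2 - 2 * b * ρ + ρ ^ 2 / l := by
          field_simp
          ring
        linarith
      have h5 : 2 * ρ ^ 2 / l = ρ ^ 2 / l + ρ ^ 2 / l := by ring
      linarith)
  have hint : ∫ t in (T / 2)..T, (l * ‖dirichletPoly x N t‖ ^ 2 + 2 * ρ ^ 2 / l) =
      l * S₂ + c ^ 2 * T ^ (1 - 2 * σ) / l := by
    rw [intervalIntegral.integral_add
      (Continuous.intervalIntegrable (by have := continuous_dirichletPoly x N; fun_prop) _ _)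
      intervalIntegrable_const, intervalIntegral.integral_const_mul,
      intervalIntegral.integral_const, smul_eq_mul, ← hρ2]
    ring
  rw [hint] at hb
  have hX : 0 < T ^ (2 - 2 * σ) := by positivity
  have hY : 0 < T ^ (1 - 2 * σ) / l := by positivity
  have hZ : 0 ≤ l * (T * sqSum x N) := mul_nonneg hl0.le (mul_nonneg hT0.le (sqSum_nonneg x N))
  have h6 : l * S₂ ≤ l * (T * sqSum x N) + C₁ * T ^ (2 - 2 * σ) := by
    have i1 := mul_le_mul_of_nonneg_left hS₂le hl0.le
    have i2 : 0 ≤ C₁ * T ^ (2 - 2 * σ) := by positivity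
    have i3 := mul_le_mul_of_nonneg_right hl1 i2
    linarith
  rw [show T - T / 2 = T / 2 by ring] at hb
  have h7 : c ^ 2 * T ^ (1 - 2 * σ) / l = c ^ 2 * (T ^ (1 - 2 * σ) / l) := by ring
  rw [h7] at hb
  have j1 := mul_nonneg hC₁0 hY.le
  have j2 := mul_nonneg hC₁0 hZ
  have j3 := mul_nonneg (sq_nonneg c) hX.le
  have j4 := mul_nonneg (sq_nonneg c) hZ
  have j5 := mul_nonneg (sq_nonneg c) hY.le
  nlinarith

theorem integral_sub_integral_half (h : IsApprox F x σ C κ) {T : ℝ} (hT : 4 ≤ T) :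
    (∫ t in (2 : ℝ)..T, ‖F t‖ ^ 2) - ∫ t in (2 : ℝ)..(T / 2), ‖F t‖ ^ 2 =
      ∫ t in (T / 2)..T, ‖F t‖ ^ 2 :=
  intervalIntegral.integral_interval_sub_left
    (h.intervalIntegrable le_rfl (by linarith)) (h.intervalIntegrable le_rfl (by linarith))

theorem integral_le_of_mem_Icc (h : IsApprox F x σ C κ) {T : ℝ} (hT : T ∈ Icc (2 : ℝ) 4) :
    |∫ t in (2 : ℝ)..T, ‖F t‖ ^ 2| ≤ ∫ t in (2 : ℝ)..4, ‖F t‖ ^ 2 := by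
  rw [abs_of_nonneg (intervalIntegral.integral_nonneg hT.1 fun _ _ => by positivity)]
  exact intervalIntegral.integral_mono_interval le_rfl hT.1 hT.2
    (ae_of_all _ fun _ => by positivity) (h.intervalIntegrable le_rfl (by norm_num))

theorem mean_square_of_lt_one (h : IsApprox F x σ C κ) (hσ : 1 / 2 < σ) (hσ1 : σ < 1) :
    ∃ K : ℝ, ∀ T : ℝ, 2 ≤ T →
      |(∫ t in (2 : ℝ)..T, ‖F t‖ ^ 2) - (∑' m : ℕ, ‖x (m + 1)‖ ^ 2) * T| ≤
        K * T ^ (2 - 2 * σ) := by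
  obtain ⟨K, hK, hd⟩ := h.dyadic_mean_square hσ.le hσ1
  set V := ∑' m : ℕ, ‖x (m + 1)‖ ^ 2 with hV
  have hV0 : 0 ≤ V := tsum_nonneg fun m => by positivity
  set D := C ^ 2 / (2 * σ - 1) with hD
  have hD0 : 0 ≤ D := div_nonneg (sq_nonneg _) (by linarith)
  set I₄ := ∫ t in (2 : ℝ)..4, ‖F t‖ ^ 2 with hI
  have hI0 : 0 ≤ I₄ := intervalIntegral.integral_nonneg (by norm_num) fun _ _ => by positivity
  refine exists_le_of_dyadic (K := (I₄ + V * 4) + (K * (1 + (V + D) + 1) + D)) (by linarith)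
    (by positivity) ?_ ?_
  · intro T hT
    refine (abs_sub _ _).trans ?_
    have h1 := h.integral_le_of_mem_Icc hT
    have h2 : |V * T| ≤ V * 4 := by
      rw [abs_of_nonneg (mul_nonneg hV0 (by linarith [hT.1]))]
      exact mul_le_mul_of_nonneg_left hT.2 hV0
    have h3 : 0 ≤ K * (1 + (V + D) + 1) + D := by positivity
    linarith
  · intro T hT
    have hT0 : 0 < T := by linarith
    obtain ⟨N, hN1, hN3, hN4, hb⟩ := hd T hT
    have hN0 : (0 : ℝ) < N := by linarith
    set X := T ^ (2 - 2 * σ) with hX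
    have hX1 : 1 ≤ X := Real.one_le_rpow (by linarith) (by linarith)
    -- Since the sums of |x_m|² are bounded, this weight makes the second error term O(T^{2-2σ}) and
    -- the third one O(1).
    set l := T ^ (1 - 2 * σ) with hl
    have hl0 : 0 < l := Real.rpow_pos_of_pos hT0 _
    have hl1 : l ≤ 1 := Real.rpow_le_one_of_one_le_of_nonpos (by linarith) (by linarith)
    have hlT : l * T = X := by
      rw [hl, hX, ← Real.rpow_add_one hT0.ne']
      congr 1
      ring
    have hb1 := hb l hl0 hl1
    rw [div_self hl0.ne', ← mul_assoc, hlT] at hb1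
    have hdiff := h.abs_tsum_sub_sqSum_le hσ hN1
    rw [← hV] at hdiff
    have hNl : (N : ℝ) ^ (-(2 * σ - 1)) ≤ l := by
      rw [hl, neg_sub]
      exact Real.rpow_le_rpow_of_nonpos hT0 hN3 (by linarith)
    have hdiff' : |V - sqSum x N| ≤ D * l := hdiff.trans (mul_le_mul_of_nonneg_left hNl hD0)
    have hsq : sqSum x N ≤ V + D := by
      have h1 := (abs_le.1 hdiff').1
      have h2 : D * l ≤ D * 1 := mul_le_mul_of_nonneg_left hl1 hD0
      linarith
    have e : (∫ t in (2 : ℝ)..T, ‖F t‖ ^ 2) - V * T -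
        ((∫ t in (2 : ℝ)..(T / 2), ‖F t‖ ^ 2) - V * (T / 2)) =
        ((∫ t in (T / 2)..T, ‖F t‖ ^ 2) - T / 2 * sqSum x N) - T / 2 * (V - sqSum x N) := by
      rw [← h.integral_sub_integral_half hT]
      ring
    rw [e]
    have h1 : |T / 2 * (V - sqSum x N)| ≤ D * X := by
      rw [abs_mul, abs_of_pos (by linarith : 0 < T / 2)]
      calc T / 2 * |V - sqSum x N| ≤ T * (D * l) := by gcongr; linarith
        _ = D * X := by rw [← hlT]; ring
    have h2 : K * (X + X * sqSum x N + 1) ≤ K * (1 + (V + D) + 1) * X := by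
      calc K * (X + X * sqSum x N + 1) ≤ K * (X + X * (V + D) + X) := by gcongr
        _ = _ := by ring
    refine (abs_sub _ _).trans ((add_le_add (hb1.trans h2) h1).trans ?_)
    have h3 : 0 ≤ (I₄ + V * 4) * X := by positivity
    linarith

theorem mean_square_of_eq_half (h : IsApprox F x (1 / 2) C κ) {a b : ℝ} (ha : 0 ≤ a)
    (hx : ∀ m : ℕ, 1 ≤ m → |‖x m‖ ^ 2 - a * (m : ℝ)⁻¹| ≤ b * (m : ℝ) ^ (-2 : ℝ)) :
    ∃ K : ℝ, ∀ T : ℝ, 2 ≤ T →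
      |(∫ t in (2 : ℝ)..T, ‖F t‖ ^ 2) - a * (T * Real.log T)| ≤ K * T := by
  obtain ⟨K, hK, hd⟩ := h.dyadic_mean_square le_rfl (by norm_num)
  have hκ := h.one_le
  have hb0 : 0 ≤ b := by
    have := (abs_nonneg _).trans (hx 1 le_rfl)
    simpa using this
  set I₄ := ∫ t in (2 : ℝ)..4, ‖F t‖ ^ 2 with hI
  have hI0 : 0 ≤ I₄ := intervalIntegral.integral_nonneg (by norm_num) fun _ _ => by positivity
  have hlκ : 0 ≤ Real.log (κ + 1) := Real.log_nonneg (by linarith)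
  set D := b * 2 + a * (1 + Real.log (κ + 1)) with hD
  have hD0 : 0 ≤ D := by positivity
  have hl4 : 1 ≤ Real.log 4 := by
    rw [show (4 : ℝ) = 2 ^ 2 by norm_num, Real.log_pow]
    push_cast
    linarith [Real.log_two_gt_d9]
  have hmain := exists_le_of_dyadic (f := fun T => (∫ t in (2 : ℝ)..T, ‖F t‖ ^ 2) -
    a * (T * Real.log T)) (β := 1)
    (K := (I₄ + a * (4 * Real.log 4)) + (K * (1 + (D + a) + 1) + D + a)) one_pos
    (by positivity) ?_ ?_
  · simpa only [Real.rpow_one] using hmain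
  · intro T hT
    refine (abs_sub _ _).trans ?_
    have h1 := h.integral_le_of_mem_Icc hT
    have hT0 : 0 < T := by linarith [hT.1]
    have hl : 0 ≤ Real.log T := Real.log_nonneg (by linarith [hT.1])
    have h2 : |a * (T * Real.log T)| ≤ a * (4 * Real.log 4) := by
      rw [abs_of_nonneg (by positivity)]
      have := Real.log_le_log hT0 hT.2
      gcongr
      exact hT.2
    have h3 : 0 ≤ K * (1 + (D + a) + 1) + D + a := by positivity
    linarith
  · intro T hT
    have hT0 : 0 < T := by linarith
    obtain ⟨N, hN1, hN3, hN4, hb⟩ := hd T hT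
    have hN0 : (0 : ℝ) < N := by linarith
    have hlT : 1 ≤ Real.log T := hl4.trans (Real.log_le_log (by norm_num) hT)
    have hlT0 : 0 < Real.log T := by linarith
    have hlTT : Real.log T ≤ T := (Real.log_le_sub_one_of_pos hT0).trans (by linarith)
    -- Here ∑ |x_m|² grows like log T, so the weight 1/log T brings the second error term down to
    -- O(T), at the cost of a third term log T. It is at most 1 because T ≥ 4.
    have hb1 := hb (1 / Real.log T) (by positivity) ((div_le_one hlT0).2 hlT)
    norm_num1 at hb1
    rw [Real.rpow_one, Real.rpow_zero, one_div_one_div] at hb1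
    have hsq : |sqSum x N - a * Real.log T| ≤ D := by
      have h1 : |sqSum x N - a * ∑ m ∈ Finset.Icc 1 N, (m : ℝ)⁻¹| ≤ b * 2 := by
        rw [sqSum, Finset.mul_sum, ← Finset.sum_sub_distrib]
        refine (Finset.abs_sum_le_sum_abs _ _).trans ((Finset.sum_le_sum fun m hm =>
          hx m (Finset.mem_Icc.1 hm).1).trans ?_)
        rw [← Finset.mul_sum]
        refine mul_le_mul_of_nonneg_left ?_ hb0
        have := sum_Icc_rpow_le_of_one_lt (α := 2) (by norm_num) N
        norm_num1 at this ⊢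
        exact this
      have h2 : |∑ m ∈ Finset.Icc 1 N, (m : ℝ)⁻¹ - Real.log T| ≤ 1 + Real.log (κ + 1) := by
        have u := harmonic_le_one_add_log N
        have v := log_add_one_le_harmonic N
        rw [harmonic_eq_sum_Icc] at u v
        push_cast at u v
        have w1 : Real.log T ≤ Real.log (N + 1) := Real.log_le_log hT0 (by linarith)
        have w2 := Real.log_le_log hN0 hN4
        rw [Real.log_mul (by linarith) hT0.ne'] at w2
        rw [abs_le]
        constructor <;> linarith
      have e : sqSum x N - a * Real.log T = (sqSum x N - a * ∑ m ∈ Finset.Icc 1 N, (m : ℝ)⁻¹) +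
          a * (∑ m ∈ Finset.Icc 1 N, (m : ℝ)⁻¹ - Real.log T) := by ring
      rw [e]
      refine (abs_add_le _ _).trans (add_le_add h1 ?_)
      rw [abs_mul, abs_of_nonneg ha]
      exact mul_le_mul_of_nonneg_left h2 ha
    have hsq' : 1 / Real.log T * (T * sqSum x N) ≤ (D + a) * T := by
      have h1 := (abs_le.1 hsq).2
      rw [one_div_mul_eq_div, div_le_iff₀ hlT0]
      have h2 : sqSum x N ≤ (D + a) * Real.log T := by nlinarith
      nlinarith
    have e : (∫ t in (2 : ℝ)..T, ‖F t‖ ^ 2) - a * (T * Real.log T) -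
        ((∫ t in (2 : ℝ)..(T / 2), ‖F t‖ ^ 2) - a * (T / 2 * Real.log (T / 2))) =
        ((∫ t in (T / 2)..T, ‖F t‖ ^ 2) - T / 2 * sqSum x N) +
          T / 2 * (sqSum x N - a * Real.log T) - a * (T / 2 * Real.log 2) := by
      rw [← h.integral_sub_integral_half hT, Real.log_div hT0.ne' two_ne_zero]
      ring
    rw [e, Real.rpow_one]
    have h1 : |T / 2 * (sqSum x N - a * Real.log T)| ≤ D * T := by
      rw [abs_mul, abs_of_pos (by linarith : 0 < T / 2)]
      nlinarith [abs_nonneg (sqSum x N - a * Real.log T)]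
    have h2 : |a * (T / 2 * Real.log 2)| ≤ a * T := by
      have l0 : 0 ≤ Real.log 2 := Real.log_nonneg (by norm_num)
      rw [abs_of_nonneg (by positivity)]
      refine mul_le_mul_of_nonneg_left ?_ ha
      nlinarith [Real.log_two_lt_d9]
    have h3 : K * (T + 1 / Real.log T * (T * sqSum x N) + Real.log T) ≤
        K * (1 + (D + a) + 1) * T := by
      calc K * (T + 1 / Real.log T * (T * sqSum x N) + Real.log T) ≤
          K * (T + (D + a) * T + T) := by gcongr
        _ = _ := by ring
    refine (abs_sub _ _).trans ((add_le_add ((abs_add_le _ _).trans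
      (add_le_add (hb1.trans h3) h1)) h2).trans ?_)
    have h4 : 0 ≤ (I₄ + a * (4 * Real.log 4)) * T := by positivity
    linarith

end IsApprox

/-! ### The approximation of the double zeta-function -/

/-- The coefficient `m^{-σ₁} (ζ(s₂) - ∑_{n ≤ m} n^{-s₂})`. -/
noncomputable def zeta₂Coeff (σ₁ : ℝ) (s₂ : ℂ) (m : ℕ) : ℂ :=
  (m : ℂ) ^ (-(σ₁ : ℂ)) * (riemannZeta s₂ - ∑ n ∈ Finset.Icc 1 m, 1 / (n : ℂ) ^ s₂)

theorem sq_norm_zeta₂Coeff (σ₁ : ℝ) (s₂ : ℂ) {m : ℕ} (hm : 1 ≤ m) :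
    ‖zeta₂Coeff σ₁ s₂ m‖ ^ 2 = zeta₂₁Term (2 * σ₁) s₂ m := by
  rw [zeta₂Coeff, norm_mul, mul_pow, norm_natCast_cpow hm, zeta₂₁Term, Complex.neg_re,
    Complex.ofReal_re, ← Real.rpow_mul_natCast (Nat.cast_nonneg m), one_div,
    ← Real.rpow_neg (Nat.cast_nonneg m)]
  congr 2
  push_cast
  ring

theorem tsum_sq_norm_zeta₂Coeff (σ₁ : ℝ) (s₂ : ℂ) :
    ∑' m : ℕ, ‖zeta₂Coeff σ₁ s₂ (m + 1)‖ ^ 2 = zeta₂₁ (2 * σ₁) s₂ :=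
  tsum_congr fun m => sq_norm_zeta₂Coeff σ₁ s₂ (Nat.le_add_left 1 m)

theorem zeta₂Coeff_eq (σ₁ : ℝ) (s₂ : ℂ) {m : ℕ} (hm : 1 ≤ m) :
    zeta₂Coeff σ₁ s₂ m = (m : ℂ) ^ (-(σ₁ : ℂ)) * zetaErr m s₂ +
      (m : ℂ) ^ (1 - σ₁ - s₂) / (s₂ - 1) := by
  have hm0 : (m : ℂ) ≠ 0 := by exact_mod_cast (by omega : m ≠ 0)
  rw [zeta₂Coeff, zetaErr, show 1 - σ₁ - s₂ = -(σ₁ : ℂ) + (1 - s₂) by ring,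
    Complex.cpow_add _ _ hm0]
  ring

theorem exists_zetaErr_bound {s₂ : ℂ} (hs : s₂ ≠ 1) : ∃ B : ℝ, 0 ≤ B ∧ ∀ m : ℕ, 1 ≤ m →
    ‖zetaErr m s₂‖ ≤ B * (m : ℝ) ^ (-s₂.re) := by
  obtain ⟨J, hJ⟩ := exists_nat_gt (-s₂.re)
  obtain ⟨B, -, hB⟩ := exists_norm_zetaErr_le J
  refine ⟨B s₂, ?_, hB s₂ hs (by linarith)⟩
  simpa using (norm_nonneg _).trans (hB s₂ hs (by linarith) 1 le_rfl)

/-- With σ = σ₁ + Re s₂ - 1, the coefficient is a term of exact modulus |s₂-1|^{-1} m^{-σ} plus a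
remainder O(m^{-σ-1}). The second bound is needed only on the critical line σ = 1/2. -/
theorem exists_zeta₂Coeff_bounds (σ₁ : ℝ) {s₂ : ℂ} (hs : s₂ ≠ 1) : ∃ C : ℝ, 0 ≤ C ∧
    ∀ m : ℕ, 1 ≤ m → ‖zeta₂Coeff σ₁ s₂ m‖ ≤ C * (m : ℝ) ^ (-(σ₁ + s₂.re - 1)) ∧
      |‖zeta₂Coeff σ₁ s₂ m‖ ^ 2 -
        (‖s₂ - 1‖ ^ 2)⁻¹ * (m : ℝ) ^ (-(2 * (σ₁ + s₂.re - 1)))| ≤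
        C * (m : ℝ) ^ (-(2 * (σ₁ + s₂.re - 1) + 1)) := by
  obtain ⟨B, hB0, hB⟩ := exists_zetaErr_bound hs
  set σ := σ₁ + s₂.re - 1 with hσ
  set c := ‖s₂ - 1‖⁻¹ with hc
  have hc0 : 0 ≤ c := by positivity
  refine ⟨(B + c) + (2 * c * B + B ^ 2), by positivity, fun m hm => ?_⟩
  have hm0 : (0 : ℝ) < m := by exact_mod_cast hm
  have hm1 : (1 : ℝ) ≤ m := by exact_mod_cast hm
  have h1 : ‖(m : ℂ) ^ (-(σ₁ : ℂ)) * zetaErr m s₂‖ ≤ B * (m : ℝ) ^ (-(σ + 1)) := by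
    refine (norm_term_le hm (hB m hm)).trans_eq ?_
    simp [hσ]
  have h2 : ‖(m : ℂ) ^ (1 - σ₁ - s₂) / (s₂ - 1)‖ = c * (m : ℝ) ^ (-σ) := by
    rw [norm_div, norm_natCast_cpow hm, hc, mul_comm, div_eq_mul_inv]
    congr 2
    simp [hσ]
    ring
  have h3 : (m : ℝ) ^ (-(σ + 1)) ≤ (m : ℝ) ^ (-σ) :=
    Real.rpow_le_rpow_of_exponent_le hm1 (by linarith)
  have hY : 0 < (m : ℝ) ^ (-σ) := by positivity
  have hX : 0 < (m : ℝ) ^ (-(σ + 1)) := by positivity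
  have hXY : (m : ℝ) ^ (-(2 * σ + 1)) = (m : ℝ) ^ (-(σ + 1)) * (m : ℝ) ^ (-σ) := by
    rw [← Real.rpow_add hm0]
    congr 1
    ring
  have hYY : (m : ℝ) ^ (-(2 * σ)) = ((m : ℝ) ^ (-σ)) ^ 2 := by
    rw [← Real.rpow_mul_natCast hm0.le]
    congr 1
    push_cast
    ring
  rw [zeta₂Coeff_eq σ₁ s₂ hm, hXY, hYY]
  constructor
  · refine (norm_add_le _ _).trans ?_
    rw [h2]
    have e1 := mul_le_mul_of_nonneg_left h3 hB0
    have e2 : 0 ≤ (2 * c * B + B ^ 2) * (m : ℝ) ^ (-σ) := by positivity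
    linarith
  · have h4 : (‖s₂ - 1‖ ^ 2)⁻¹ * ((m : ℝ) ^ (-σ)) ^ 2 =
        ‖(m : ℂ) ^ (1 - σ₁ - s₂) / (s₂ - 1)‖ ^ 2 := by
      rw [h2, hc, mul_pow, inv_pow]
    rw [h4]
    refine (abs_sq_norm_sub_le (ρ := B * (m : ℝ) ^ (-(σ + 1))) (by simpa using h1)).trans ?_
    rw [h2]
    have e1 : (B * (m : ℝ) ^ (-(σ + 1))) ^ 2 ≤
        B ^ 2 * ((m : ℝ) ^ (-(σ + 1)) * (m : ℝ) ^ (-σ)) := by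
      rw [mul_pow, sq ((m : ℝ) ^ (-(σ + 1)))]
      gcongr
    have e2 : 0 ≤ (B + c) * ((m : ℝ) ^ (-(σ + 1)) * (m : ℝ) ^ (-σ)) := by positivity
    linarith

/-- Compactness handles bounded t, where the path misses the zero, and the triangle inequality
handles t ≥ 2|z| + 2. It serves to bound the distance from w to the pole of ζ(w) below by a multiple
of t. -/
theorem exists_mul_le_norm_add {z : ℂ} (hz : ∀ t : ℝ, 2 ≤ t → z + t * Complex.I ≠ 0) :
    ∃ c > 0, ∀ t : ℝ, 2 ≤ t → c * t ≤ ‖z + t * Complex.I‖ := by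
  set R := 2 * ‖z‖ + 2 with hR
  obtain ⟨t₀, ht₀, hmin⟩ := (isCompact_Icc (a := (2 : ℝ)) (b := R)).exists_isMinOn
    (nonempty_Icc.2 (by linarith [norm_nonneg z]))
    (by fun_prop : Continuous fun t : ℝ => ‖z + t * Complex.I‖).continuousOn
  have hR0 : 0 < R := by positivity
  set d := ‖z + t₀ * Complex.I‖ with hd
  have hd0 : 0 < d := norm_pos_iff.2 (hz t₀ ht₀.1)
  refine ⟨min (d / R) (1 / 2), by positivity, fun t ht => ?_⟩
  have ht0 : 0 < t := by linarith
  rcases le_total t R with h | h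
  · calc min (d / R) (1 / 2) * t ≤ d / R * R := by
          gcongr
          exact min_le_left _ _
      _ = d := by field_simp
      _ ≤ _ := hmin ⟨ht, h⟩
  · have h1 : ‖(t : ℂ) * Complex.I‖ = t := by
      rw [norm_mul, Complex.norm_I, mul_one, Complex.norm_real, Real.norm_of_nonneg ht0.le]
    have h2 := norm_sub_le (z + t * Complex.I) z
    rw [add_sub_cancel_left, h1] at h2
    calc min (d / R) (1 / 2) * t ≤ 1 / 2 * t := by
          gcongr
          exact min_le_right _ _
      _ ≤ _ := by linarith

theorem cpow_neg_eq_mul_exp {m : ℕ} (hm : 1 ≤ m) (σ₁ t : ℝ) :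
    (m : ℂ) ^ (-((σ₁ : ℂ) + t * Complex.I)) =
      (m : ℂ) ^ (-(σ₁ : ℂ)) * Complex.exp (-(t * Real.log m * Complex.I)) := by
  rw [natCast_cpow_eq_exp hm, natCast_cpow_eq_exp hm, ← Complex.exp_add]
  congr 1
  ring

/-- Each x_m m^{-it} equals m^{-s₁} E_m(s₂) + m^{-w}/(s₂-1) with w = s₁+s₂-1. Truncation at N thus
leaves the tail of the absolutely convergent series and the remainder of ζ(w) after N terms. -/
theorem doubleZetaCont_sub_dirichletPoly {σ₁ : ℝ} {s₂ : ℂ} (hs : s₂ ≠ 1)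
    (hσ : 1 < σ₁ + s₂.re) (t : ℝ) (N : ℕ) :
    doubleZetaCont ((σ₁ : ℂ) + t * Complex.I, s₂) - dirichletPoly (zeta₂Coeff σ₁ s₂) N t =
      (zetaErr N (σ₁ + t * Complex.I + s₂ - 1) +
        (N : ℂ) ^ (1 - (σ₁ + t * Complex.I + s₂ - 1)) / (σ₁ + t * Complex.I + s₂ - 1 - 1)) /
        (s₂ - 1) +
      ∑' i : ℕ, ((i + N + 1 : ℕ) : ℂ) ^ (-((σ₁ : ℂ) + t * Complex.I)) *
        zetaErr (i + N + 1) s₂ := by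
  set s₁ : ℂ := (σ₁ : ℂ) + t * Complex.I with hs₁
  have hre : 1 < (s₁ + s₂).re := by simpa [hs₁] using hσ
  obtain ⟨V, -, hpV, -, u, hu, hVu⟩ := exists_nhds_term_bound (p₀ := (s₁, s₂)) hs hre
  have hsum : Summable fun m : ℕ => ((m + 1 : ℕ) : ℂ) ^ (-s₁) * zetaErr (m + 1) s₂ :=
    Summable.of_norm_bounded hu fun m => hVu m (s₁, s₂) hpV
  have hpoly : dirichletPoly (zeta₂Coeff σ₁ s₂) N t =
      (∑ m ∈ Finset.range N, ((m + 1 : ℕ) : ℂ) ^ (-s₁) * zetaErr (m + 1) s₂) +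
      (∑ m ∈ Finset.Icc 1 N, 1 / (m : ℂ) ^ (s₁ + s₂ - 1)) / (s₂ - 1) := by
    have e : ∑ m ∈ Finset.range N, ((m + 1 : ℕ) : ℂ) ^ (-s₁) * zetaErr (m + 1) s₂ =
        ∑ m ∈ Finset.Icc 1 N, (m : ℂ) ^ (-s₁) * zetaErr m s₂ := by
      rw [← Finset.Ico_succ_right_eq_Icc, Finset.sum_Ico_eq_sum_range]
      exact Finset.sum_congr (by simp) fun k _ => by rw [add_comm]
    rw [e, Finset.sum_div, ← Finset.sum_add_distrib, dirichletPoly]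
    refine Finset.sum_congr rfl fun m hm => ?_
    have hm1 := (Finset.mem_Icc.1 hm).1
    have hm0 : (m : ℂ) ≠ 0 := by exact_mod_cast (by omega : m ≠ 0)
    rw [zeta₂Coeff_eq σ₁ s₂ hm1, cpow_neg_eq_mul_exp hm1, one_div, ← Complex.cpow_neg,
      show -(s₁ + s₂ - 1) = -s₁ + (1 - s₂) by ring, Complex.cpow_add _ _ hm0, hs₁,
      cpow_neg_eq_mul_exp hm1, show 1 - σ₁ - s₂ = -(σ₁ : ℂ) + (1 - s₂) by ring,
      Complex.cpow_add _ _ hm0]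
    ring
  rw [hpoly, doubleZetaCont, ← hsum.sum_add_tsum_nat_add N, zetaErr]
  ring

theorem continuousOn_zeta₂_line {σ₁ : ℝ} {s₂ : ℂ} (hσ : 1 < σ₁ + s₂.re)
    (hreg : ∀ t : ℝ, 2 ≤ t → ((σ₁ : ℂ) + (t : ℂ) * Complex.I, s₂) ∈ regularSet) :
    ContinuousOn (fun t : ℝ => zeta₂ ((σ₁ : ℂ) + (t : ℂ) * Complex.I) s₂) (Ici 2) := by
  have hre : ∀ t : ℝ, 1 < ((σ₁ : ℂ) + (t : ℂ) * Complex.I + s₂).re := fun t => by simpa using hσ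
  have h : ContinuousOn (fun t : ℝ => doubleZetaCont ((σ₁ : ℂ) + (t : ℂ) * Complex.I, s₂))
      (Ici 2) := by
    intro t ht
    have h1 := (isContinuation_doubleZetaCont.1 _ ⟨hreg t ht, hre t⟩).continuousAt
    exact (ContinuousAt.comp (f := fun t : ℝ => ((σ₁ : ℂ) + (t : ℂ) * Complex.I, s₂)) h1
      (by fun_prop)).continuousWithinAt
  exact h.congr fun t ht => zeta₂_eq_doubleZetaCont (hreg t ht) (hre t)

theorem exists_isApprox_zeta₂ {σ₁ : ℝ} {s₂ : ℂ} (hσ : 1 < σ₁ + s₂.re)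
    (hreg : ∀ t : ℝ, 2 ≤ t → ((σ₁ : ℂ) + (t : ℂ) * Complex.I, s₂) ∈ regularSet) :
    ∃ C κ : ℝ, IsApprox (fun t : ℝ => zeta₂ ((σ₁ : ℂ) + (t : ℂ) * Complex.I) s₂)
      (zeta₂Coeff σ₁ s₂) (σ₁ + s₂.re - 1) C κ := by
  have hs : s₂ ≠ 1 := (hreg 2 le_rfl).1
  obtain ⟨C₁, hC₁, hcoeff⟩ := exists_zeta₂Coeff_bounds σ₁ hs
  obtain ⟨B, hB0, hB⟩ := exists_zetaErr_bound hs
  set σ := σ₁ + s₂.re - 1 with hσdef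
  have hσ0 : 0 < σ := by linarith
  obtain ⟨κ, hκ, C₂, hC₂, happ⟩ := exists_norm_zetaErr_le_of_height_le hσ0
  set z : ℂ := σ₁ + s₂ - 2 with hz
  obtain ⟨c, hc, hlow⟩ := exists_mul_le_norm_add (z := z) (fun t ht h => by
    apply (hreg t ht).2.1
    rw [hz] at h
    linear_combination h)
  set b := ‖s₂ - 1‖⁻¹ with hb
  have hb0 : 0 ≤ b := by positivity
  -- For t ≥ 2 one has 1 + |1 - w| ≤ 1 + |z| + t ≤ (2 + |z|) t, so N ≥ κ' t meets the height
  -- condition for ζ(w).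
  set κ' := max 1 (κ * (2 + ‖z‖)) with hκ'
  have hκ'1 : 1 ≤ κ' := le_max_left _ _
  -- The summands come from the remainder of ζ(w), from N^{1-w}/(w-1) and from the tail of the
  -- absolutely convergent series. The first and third are O(N^{-σ}), absorbed in N^{1-σ}/t because
  -- t ≤ N.
  set C₃ := (C₂ * (1 + 1 / (c * 2)) + 1 / c) * b + B / σ with hC₃
  have hC₃0 : 0 ≤ C₃ := by positivity
  refine ⟨C₁ + C₃, κ', continuousOn_zeta₂_line hσ hreg, hκ'1, by positivity, fun m hm =>
    (hcoeff m hm).1.trans (by gcongr; linarith), fun t N ht hN => ?_⟩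
  have ht0 : 0 < t := by linarith
  have hNt : t ≤ N := le_trans (by nlinarith) hN
  have hN0 : (0 : ℝ) < N := by linarith
  have hN1 : 1 ≤ N := by exact_mod_cast (by linarith : (1 : ℝ) ≤ N)
  have hre : 1 < ((σ₁ : ℂ) + (t : ℂ) * Complex.I + s₂).re := by simpa using hσ
  set w : ℂ := σ₁ + t * Complex.I + s₂ - 1 with hw
  have hw1 : w - 1 = z + t * Complex.I := by rw [hw, hz]; ring
  have hwre : w.re = σ := by simp [hw, hσdef]
  have hwlow : c * t ≤ ‖w - 1‖ := by rw [hw1]; exact hlow t ht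
  have hct : 0 < c * t := by positivity
  have hwne : w ≠ 1 := sub_ne_zero.1 (norm_pos_iff.1 (hct.trans_le hwlow))
  have hwup : ‖1 - w‖ ≤ ‖z‖ + t := by
    rw [norm_sub_rev, hw1]
    refine (norm_add_le _ _).trans_eq ?_
    rw [norm_mul, Complex.norm_I, mul_one, Complex.norm_real, Real.norm_of_nonneg ht0.le]
  have hκN : κ * (1 + ‖1 - w‖) ≤ N := by
    refine le_trans ?_ hN
    calc κ * (1 + ‖1 - w‖) ≤ κ * ((2 + ‖z‖) * t) := by
          gcongr
          nlinarith [norm_nonneg z]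
      _ = κ * (2 + ‖z‖) * t := by ring
      _ ≤ κ' * t := by
          gcongr
          exact le_max_right _ _
  set X := (N : ℝ) ^ (1 - σ) / t with hX
  have hX0 : 0 < X := by positivity
  have hNX : (N : ℝ) ^ (-σ) ≤ X := by
    rw [hX, show -σ = (1 - σ) - 1 by ring, Real.rpow_sub_one hN0.ne']
    gcongr
  have e1 : ‖zetaErr N w‖ ≤ C₂ * (1 + 1 / (c * 2)) * X := by
    have h1 := happ w N hwne hwre hN1 hκN
    have h2 : 1 / ‖1 - w‖ ≤ 1 / (c * 2) := by
      rw [norm_sub_rev]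
      refine one_div_le_one_div_of_le (by positivity) (le_trans ?_ hwlow)
      gcongr
    refine h1.trans ?_
    gcongr
  have e2 : ‖(N : ℂ) ^ (1 - w) / (w - 1)‖ ≤ 1 / c * X := by
    rw [norm_div, norm_natCast_cpow hN1, Complex.sub_re, Complex.one_re, hwre]
    calc (N : ℝ) ^ (1 - σ) / ‖w - 1‖ ≤ (N : ℝ) ^ (1 - σ) / (c * t) := by gcongr
      _ = 1 / c * X := by rw [hX]; field_simp
  have e3 : ‖∑' i : ℕ, ((i + N + 1 : ℕ) : ℂ) ^ (-((σ₁ : ℂ) + t * Complex.I)) *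
      zetaErr (i + N + 1) s₂‖ ≤ B / σ * X := by
    have hsum := (summable_rpow_shift hσ0 hN1).mul_left B
    refine (tsum_of_norm_bounded hsum.hasSum fun i => ?_).trans ?_
    · refine (norm_term_le (by omega) (hB (i + N + 1) (by omega))).trans_eq ?_
      have : ((σ₁ : ℂ) + t * Complex.I + s₂).re = σ + 1 := by simp [hσdef]
      rw [this]
      push_cast
      ring_nf
    · rw [tsum_mul_left]
      calc B * _ ≤ B * ((N : ℝ) ^ (-σ) / σ) := by
            gcongr
            exact tsum_rpow_shift_le hσ0 hN1
        _ = B / σ * (N : ℝ) ^ (-σ) := by ring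
        _ ≤ _ := by gcongr
  rw [zeta₂_eq_doubleZetaCont (hreg t ht) hre, doubleZetaCont_sub_dirichletPoly hs hσ]
  calc _ ≤ (C₂ * (1 + 1 / (c * 2)) * X + 1 / c * X) * b + B / σ * X := by
        refine (norm_add_le _ _).trans (add_le_add ?_ e3)
        rw [norm_div, div_eq_mul_inv]
        gcongr
        exact (norm_add_le _ _).trans (add_le_add e1 e2)
    _ = C₃ * X := by rw [hC₃]; ring
    _ ≤ (C₁ + C₃) * X := by
        gcongr
        linarith

end EulerDoubleZeta

theorem theorem1p1 (σ₁ : ℝ) (s₂ : ℂ) :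
    -- convergence of the series in the main term
    (s₂ ≠ 1 → 3 / 2 < σ₁ + s₂.re →
      Summable (fun m : ℕ => EulerDoubleZeta.zeta₂₁Term (2 * σ₁) s₂ (m + 1))) ∧
    -- the mean value theorem, when the path avoids the singularities
    ((∀ t : ℝ, 2 ≤ t →
        ((σ₁ : ℂ) + (t : ℂ) * Complex.I, s₂) ∈ EulerDoubleZeta.regularSet) →
      (3 / 2 ≤ σ₁ + s₂.re → ∀ T : ℝ, 2 ≤ T →
        IntervalIntegrable
          (fun t : ℝ => ‖EulerDoubleZeta.zeta₂ ((σ₁ : ℂ) + (t : ℂ) * Complex.I) s₂‖ ^ 2)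
          MeasureTheory.volume 2 T) ∧
      (2 < σ₁ + s₂.re → ∃ C : ℝ, ∀ T : ℝ, 2 ≤ T →
        |EulerDoubleZeta.meanSquare σ₁ s₂ T - EulerDoubleZeta.zeta₂₁ (2 * σ₁) s₂ * T| ≤ C) ∧
      (3 / 2 < σ₁ + s₂.re → σ₁ + s₂.re < 2 → ∃ C : ℝ, ∀ T : ℝ, 2 ≤ T →
        |EulerDoubleZeta.meanSquare σ₁ s₂ T - EulerDoubleZeta.zeta₂₁ (2 * σ₁) s₂ * T| ≤
          C * T ^ (4 - 2 * σ₁ - 2 * s₂.re)) ∧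
      (σ₁ + s₂.re = 2 → ∃ C : ℝ, ∀ T : ℝ, 2 ≤ T →
        |EulerDoubleZeta.meanSquare σ₁ s₂ T - EulerDoubleZeta.zeta₂₁ (2 * σ₁) s₂ * T| ≤
          C * (Real.log T) ^ 2) ∧
      (σ₁ + s₂.re = 3 / 2 → ∃ C : ℝ, ∀ T : ℝ, 2 ≤ T →
        |EulerDoubleZeta.meanSquare σ₁ s₂ T - (‖s₂ - 1‖ ^ 2)⁻¹ * (T * Real.log T)| ≤
          C * T)) := by
  refine ⟨fun hs hσ => ?_, fun hreg => ⟨fun hσ T hT => ?_, fun hσ => ?_, fun hσ hσ2 => ?_,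
    fun hσ => ?_, fun hσ => ?_⟩⟩
  · obtain ⟨C, hC, hb⟩ := EulerDoubleZeta.exists_zeta₂Coeff_bounds σ₁ hs
    have hsum : Summable fun m : ℕ => ((m + 1 : ℕ) : ℝ) ^ (-(2 * (σ₁ + s₂.re - 1))) :=
      (summable_nat_add_iff 1).2 (Real.summable_nat_rpow.2 (by linarith))
    refine Summable.of_nonneg_of_le (fun m => ?_) (fun m => ?_) (hsum.mul_left (C ^ 2))
    · rw [← EulerDoubleZeta.sq_norm_zeta₂Coeff σ₁ s₂ (Nat.le_add_left 1 m)]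
      positivity
    · rw [← EulerDoubleZeta.sq_norm_zeta₂Coeff σ₁ s₂ (Nat.le_add_left 1 m)]
      refine (pow_le_pow_left₀ (norm_nonneg _) (hb (m + 1) (Nat.le_add_left 1 m)).1 2).trans_eq ?_
      rw [mul_pow, ← Real.rpow_mul_natCast (Nat.cast_nonneg _)]
      congr 2
      push_cast
      ring
  · obtain ⟨C, κ, h⟩ := EulerDoubleZeta.exists_isApprox_zeta₂ (by linarith) hreg
    exact h.intervalIntegrable le_rfl hT
  · obtain ⟨C, κ, h⟩ := EulerDoubleZeta.exists_isApprox_zeta₂ (by linarith) hreg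
    rw [← EulerDoubleZeta.tsum_sq_norm_zeta₂Coeff]
    exact h.mean_square_of_one_lt (by linarith)
  · obtain ⟨C, κ, h⟩ := EulerDoubleZeta.exists_isApprox_zeta₂ (by linarith) hreg
    rw [← EulerDoubleZeta.tsum_sq_norm_zeta₂Coeff,
      show 4 - 2 * σ₁ - 2 * s₂.re = 2 - 2 * (σ₁ + s₂.re - 1) by ring]
    exact h.mean_square_of_lt_one (by linarith) (by linarith)
  · obtain ⟨C, κ, h⟩ := EulerDoubleZeta.exists_isApprox_zeta₂ (by linarith) hreg
    rw [← EulerDoubleZeta.tsum_sq_norm_zeta₂Coeff]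
    rw [show σ₁ + s₂.re - 1 = 1 by linarith] at h
    exact h.mean_square_of_eq_one
  · obtain ⟨C, κ, h⟩ := EulerDoubleZeta.exists_isApprox_zeta₂ (by linarith) hreg
    obtain ⟨B, hB, hb⟩ := EulerDoubleZeta.exists_zeta₂Coeff_bounds σ₁ (hreg 2 le_rfl).1
    -- At this exponent the second coefficient bound reads |x_m|² = |s₂-1|^{-2} m^{-1} + O(m^{-2}),
    -- as the logarithmic case requires.
    rw [show σ₁ + s₂.re - 1 = 1 / 2 by linarith] at h hb
    refine h.mean_square_of_eq_half (by positivity) (b := B) fun m hm => ?_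
    have := (hb m hm).2
    norm_num1 at this
    rwa [Real.rpow_neg_one] at this
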